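/- Let $\Lambda < \mathrm{GL}(m,\mathbb{C})$ be an arithmetic group, in the following sense: there are a linear algebraic group $G < \mathrm{GL}_n$ defined over $\mathbb{Q}$ and a homomorphism $\varphi\colon G(\mathbb{R}) \to \mathrm{GL}(m,\mathbb{C})$, given by polynomials with complex coefficients in the entries of $g$ and $g^{-1}$ and with compact kernel, such that $\Lambda$ and $\varphi(G(\mathbb{Z}))$ are commensurable, where $G(\mathbb{Z}) = G \cap \mathrm{GL}(n,\mathbb{Z})$. (This includes all arithmetic lattices in linear semisimple Lie groups.) Let $\Gamma < \Lambda$ be a torsion free, virtually unipotent subgroup; that is, $\Gamma$ has no nontrivial element of finite order, and some finite index subgroup of $\Gamma$ is conjugate in $\mathrm{GL}(m,\mathbb{C})$ into the group of upper triangular matrices with ones along the diagonal. Let $\eta \in \Lambda$ be a semisimple element; that is, $\eta$ is diagonalizable over $\mathbb{C}$ and $\eta \neq 1$. Then there exists a finite index subgroup $\Lambda_0$ of $\Lambda$ such that $\Gamma < \Lambda_0$ and $[\eta]_\Lambda \cap \Lambda_0 = \emptyset$, where $[\eta]_\Lambda = \{\lambda\eta\lambda^{-1} : \lambda \in \Lambda\}$.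 -/

import Mathlib

open Matrix

/-- `G ≤ GL(n, ℂ)` is a linear algebraic group defined over `ℚ`: it is the set of common zeros in
`GL(n, ℂ)` of a family of polynomials with rational coefficients in the matrix entries. -/
def IsAlgebraicOverRat {n : ℕ} (G : Subgroup (GL (Fin n) ℂ)) : Prop :=
  ∃ S : Set (MvPolynomial (Fin n × Fin n) ℚ), ∀ g : GL (Fin n) ℂ,
    g ∈ G ↔ ∀ p ∈ S,
      MvPolynomial.aeval (fun ij : Fin n × Fin n => (g : Matrix (Fin n) (Fin n) ℂ) ij.1 ij.2) p = 0

/-- The group of real points `G(ℝ) = G ∩ GL(n, ℝ)`. -/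
def realPoints {n : ℕ} (G : Subgroup (GL (Fin n) ℂ)) : Subgroup (GL (Fin n) ℝ) :=
  G.comap (GeneralLinearGroup.map Complex.ofRealHom)

/-- The group of integral points `G(ℤ) = G ∩ GL(n, ℤ)`, as a subgroup of `G(ℝ)`. -/
def integralPoints {n : ℕ} (G : Subgroup (GL (Fin n) ℂ)) : Subgroup (realPoints G) :=
  (GeneralLinearGroup.map (Int.castRingHom ℝ)).range.subgroupOf (realPoints G)

/-- A homomorphism from a group of real matrices to `GL(m, ℂ)` is rational (a morphism of real
algebraic groups) if each entry of `φ g` is a fixed polynomial, with complex coefficients, in the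
entries of `g` and of `g⁻¹`. -/
def IsRationalHom {n m : ℕ} {H : Subgroup (GL (Fin n) ℝ)} (φ : H →* GL (Fin m) ℂ) : Prop :=
  ∃ P : Fin m → Fin m → MvPolynomial ((Fin n × Fin n) ⊕ (Fin n × Fin n)) ℂ,
    ∀ (g : H) (i j : Fin m), (φ g : Matrix (Fin m) (Fin m) ℂ) i j =
      MvPolynomial.eval
        (Sum.elim
          (fun kl => (((g : GL (Fin n) ℝ) : Matrix (Fin n) (Fin n) ℝ) kl.1 kl.2 : ℂ))
          (fun kl => ((((g : GL (Fin n) ℝ)⁻¹ : GL (Fin n) ℝ) :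
            Matrix (Fin n) (Fin n) ℝ) kl.1 kl.2 : ℂ)))
        (P i j)

/-- `Λ ≤ GL(m, ℂ)` is arithmetic: up to commensurability it is the image of the group `G(ℤ)` of
integral points of a linear algebraic group `G` defined over `ℚ` under a rational homomorphism
`φ : G(ℝ) → GL(m, ℂ)` with compact kernel.

No condition is put on `G`, and `Λ` need not consist of rational (or even real) matrices. The
arithmetic lattices in a linear semisimple Lie group are the case where `G` is semisimple and
`φ (G(ℝ))` is, up to finite index, the given Lie group; they are then lattices there. -/
def IsArithmetic {m : ℕ} (Λ : Subgroup (GL (Fin m) ℂ)) : Prop :=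
  ∃ (n : ℕ) (G : Subgroup (GL (Fin n) ℂ)) (φ : realPoints G →* GL (Fin m) ℂ),
    IsAlgebraicOverRat G ∧ IsRationalHom φ ∧
    IsCompact ((φ.ker.map (realPoints G).subtype : Subgroup (GL (Fin n) ℝ)) :
      Set (GL (Fin n) ℝ)) ∧
    Subgroup.Commensurable Λ ((integralPoints G).map φ)

/-- The matrix `g` is diagonalizable over `ℂ`, that is, the unipotent factor of its Jordan
decomposition is trivial. -/
def IsDiagonalizableElt {m : ℕ} (g : GL (Fin m) ℂ) : Prop :=
  ∃ P : GL (Fin m) ℂ, ((P * g * P⁻¹ : GL (Fin m) ℂ) : Matrix (Fin m) (Fin m) ℂ).IsDiag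

/-- Semisimple elements, with the convention that the trivial element counts as unipotent and not
as semisimple. -/
def IsSemisimpleElt {m : ℕ} (g : GL (Fin m) ℂ) : Prop :=
  IsDiagonalizableElt g ∧ g ≠ 1

/-- `U` is unipotent: it is conjugate in `GL(m, ℂ)` into the group of upper triangular matrices
with ones along the diagonal. -/
def IsUnipotentSubgroup {m : ℕ} (U : Subgroup (GL (Fin m) ℂ)) : Prop :=
  ∃ P : GL (Fin m) ℂ, ∀ u ∈ U,
    (∀ i j : Fin m, j < i → ((P * u * P⁻¹ : GL (Fin m) ℂ) : Matrix (Fin m) (Fin m) ℂ) i j = 0) ∧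
    ∀ i : Fin m, ((P * u * P⁻¹ : GL (Fin m) ℂ) : Matrix (Fin m) (Fin m) ℂ) i i = 1

/-- `Γ` has a unipotent subgroup of finite index. -/
def IsVirtuallyUnipotent {m : ℕ} (Γ : Subgroup (GL (Fin m) ℂ)) : Prop :=
  ∃ U : Subgroup (GL (Fin m) ℂ), U ≤ Γ ∧ U.relIndex Γ ≠ 0 ∧ IsUnipotentSubgroup U

/-! Let `G`, `φ` be the data of arithmeticity. The level 3 congruence subgroup of `G(ℤ)` maps
injectively under `φ`, so `Λ` has a torsion-free normal subgroup `L₁` of finite index with a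
faithful integral representation `ρ`, and `Γ ∩ L₁` is unipotent under `ρ`. The subgroup sought is
`Γ` times a deep congruence subgroup normal in `Λ`; its elements agree with elements of `Γ` modulo
`r`.

Infinite order (`exists_finiteIndex_forall_conj_notMem`): with `K` the index of `L₁`, no conjugate
of `η ^ K` is unipotent under `ρ`. Up to conjugation in `L₁` there are finitely many such
conjugates, so one modulus `r` detects that none of them is unipotent, whereas `K`-th powers from
`Γ` are unipotent modulo every `r`.

Finite order (`exists_finiteIndex_forall_pow_eq_one`): some power of `η` has prime order `q`, so it
is enough to avoid `q`-torsion. If `x` agrees with `γ ∈ Γ` modulo `q ^ t` and `x ^ q = 1`, then `γ ^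
q` is `q`-adically close to `1`, hence equal to `w ^ q` with `w ∈ Γ ∩ L₁`. Unipotent roots are
unique, so `γ` and `w` commute and `γ * w⁻¹` is torsion. Thus `γ = w`, which puts `x` in the
torsion-free group `L₁`. The roots come from successive approximation along powers of the
augmentation lattice, which is nilpotent by Kolchin's theorem.

The transfer through `φ` rests on exponential polynomials. If `φ g` is unipotent and `g = s * u` is
the Jordan decomposition, linear independence of the functions `k ^ i * α ^ k` separates the
exponents of `s` and `u` and forces `φ (s ^ k) = 1`. A compact kernel then bounds the powers of `s`,
so the powers of `g` grow polynomially, and an integral matrix with this property that is `1` modulo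
`3` is unipotent. -/

/-! ### Powers and roots of unipotent matrices -/

open Polynomial in
/-- The powers of a unipotent matrix depend polynomially on the exponent. -/
theorem exists_polynomial_matrix_eval_eq_pow {n : Type*} [Fintype n] [DecidableEq n]
    {u : Matrix n n ℂ} (hu : IsNilpotent (u - 1)) :
    ∃ Q : Matrix n n ℂ[X], ∀ k : ℕ, Q.map (eval (k : ℂ)) = u ^ k := by
  obtain ⟨N, hN⟩ := hu
  -- Binomial expansion of `(1 + (u - 1)) ^ k`: the coefficient `k.choose j` is a polynomial in `k`,
  -- and the terms with `j ≥ N` vanish.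
  refine ⟨∑ j ∈ Finset.range N, (descPochhammer ℂ j * C ((j.factorial : ℂ)⁻¹)) •
    ((u - 1) ^ j).map C, fun k => ?_⟩
  have h1 : u ^ k = ∑ j ∈ Finset.range (k + 1), (k.choose j : ℂ) • (u - 1) ^ j := by
    conv_lhs => rw [← sub_add_cancel u 1]
    rw [(Commute.one_right (u - 1)).add_pow]
    refine Finset.sum_congr rfl fun j _ => ?_
    rw [one_pow, mul_one, ← nsmul_eq_mul', Nat.cast_smul_eq_nsmul]
  have h2 : ∑ j ∈ Finset.range (k + 1), (k.choose j : ℂ) • (u - 1) ^ j =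
      ∑ j ∈ Finset.range N, (k.choose j : ℂ) • (u - 1) ^ j := by
    rcases le_total (k + 1) N with h | h
    · refine Finset.sum_subset (Finset.range_mono h) fun j _ hj => ?_
      rw [Nat.choose_eq_zero_of_lt (by simpa using hj)]; simp
    · refine (Finset.sum_subset (Finset.range_mono h) fun j _ hj => ?_).symm
      rw [pow_eq_zero_of_le (by simpa using hj) hN, smul_zero]
  rw [h1, h2]
  ext a b
  simp only [Matrix.map_apply, Matrix.sum_apply, Matrix.smul_apply, eval_finsetSum, smul_eq_mul,
    eval_mul, eval_C, Nat.cast_choose_eq_descPochhammer_div, div_eq_mul_inv]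

-- Multiples of `q` suffice because, for `a ^ q = b ^ q`, only the powers of `a` and `b` with
-- exponent divisible by `q` are known to agree.
open Polynomial in
theorem Polynomial.eq_of_eval_mul_natCast_eq {p r : ℂ[X]} {q : ℕ} (hq : q ≠ 0)
    (h : ∀ k : ℕ, p.eval ((q * k : ℕ) : ℂ) = r.eval ((q * k : ℕ) : ℂ)) : p = r := by
  refine Polynomial.eq_of_infinite_eval_eq p r
    (Set.Infinite.mono (s := Set.range fun k : ℕ => ((q * k : ℕ) : ℂ)) ?_ ?_)
  · rintro _ ⟨k, rfl⟩; exact h k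
  · refine Set.infinite_range_of_injective fun a b hab => ?_
    exact Nat.eq_of_mul_eq_mul_left (Nat.pos_of_ne_zero hq) (by exact_mod_cast hab)

/-- Roots of unipotent complex matrices are unique among unipotent matrices. -/
theorem Matrix.eq_of_pow_eq_pow_of_isNilpotent_sub_one {n : Type*} [Fintype n] [DecidableEq n]
    {a b : Matrix n n ℂ} (ha : IsNilpotent (a - 1)) (hb : IsNilpotent (b - 1)) {q : ℕ}
    (hq : q ≠ 0) (hab : a ^ q = b ^ q) : a = b := by
  obtain ⟨A, hA⟩ := exists_polynomial_matrix_eval_eq_pow ha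
  obtain ⟨B, hB⟩ := exists_polynomial_matrix_eval_eq_pow hb
  have hAB : A = B := by
    ext1 i j
    refine Polynomial.eq_of_eval_mul_natCast_eq hq fun k => ?_
    have h : A.map (Polynomial.eval ((q * k : ℕ) : ℂ)) = 
        B.map (Polynomial.eval ((q * k : ℕ) : ℂ)) := by
      rw [hA, hB, pow_mul, hab, ← pow_mul]
    exact congrFun₂ h i j
  rw [← pow_one a, ← hA, hAB, hB, pow_one]

theorem IsNilpotent.mapMatrix_sub_one {n : Type*} [Fintype n] [DecidableEq n] {R S : Type*}
    [CommRing R] [CommRing S] (f : R →+* S) {a : Matrix n n R} (ha : IsNilpotent (a - 1)) :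
    IsNilpotent (f.mapMatrix a - 1) := by
  rw [← map_one f.mapMatrix, ← map_sub]
  exact ha.map f.mapMatrix

theorem mapMatrix_intCast_complex_injective {n : Type*} [Fintype n] [DecidableEq n] :
    Function.Injective ((Int.castRingHom ℂ).mapMatrix (m := n)) :=
  Matrix.map_injective Int.cast_injective

theorem Matrix.int_eq_of_pow_eq_pow_of_isNilpotent_sub_one {n : Type*} [Fintype n] [DecidableEq n]
    {a b : Matrix n n ℤ} (ha : IsNilpotent (a - 1)) (hb : IsNilpotent (b - 1)) {q : ℕ}
    (hq : q ≠ 0) (hab : a ^ q = b ^ q) : a = b :=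
  mapMatrix_intCast_complex_injective <|
    Matrix.eq_of_pow_eq_pow_of_isNilpotent_sub_one (ha.mapMatrix_sub_one _)
      (hb.mapMatrix_sub_one _) hq (by rw [← map_pow, ← map_pow, hab])

/-! ### Exponential polynomials -/

open Polynomial in
/-- The value at `(k, l)` of the exponential polynomial `∑ α, c α (l) * α ^ k`, where the formal sum
`∑ α, c α • α` is encoded as an element of the group algebra of `ℂˣ` over `ℂ[X]`. -/
noncomputable def expPolyEval (k l : ℕ) : MonoidAlgebra ℂ[X] ℂˣ →+* ℂ :=
  MonoidAlgebra.liftNCRingHom (evalRingHom (l : ℂ))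
    ((Units.coeHom ℂ).comp (powMonoidHom k)) fun _ _ => Commute.all _ _

open Polynomial in
@[simp]
theorem expPolyEval_single (k l : ℕ) (α : ℂˣ) (c : ℂ[X]) :
    expPolyEval k l (MonoidAlgebra.single α c) = c.eval (l : ℂ) * (α : ℂ) ^ k := by
  simp [expPolyEval, MonoidAlgebra.liftNCRingHom]

/-- The shift operator on sequences. -/
def shiftEnd : Module.End ℂ (ℕ → ℂ) := LinearMap.funLeft ℂ ℂ Nat.succ

-- The shift minus `α` sends `c(k) α ^ k` to `α (c(k + 1) - c(k)) α ^ k`, and differencing lowers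
-- the degree of `c`.
open Polynomial in
theorem mul_pow_mem_maxGenEigenspace_shiftEnd (α : ℂ) (c : ℂ[X]) :
    (fun k : ℕ => c.eval (k : ℂ) * α ^ k) ∈ shiftEnd.maxGenEigenspace α := by
  have key : ∀ (d : ℕ) (c : ℂ[X]), c.degree < d →
      ((shiftEnd - algebraMap ℂ _ α) ^ d) (fun k : ℕ => c.eval (k : ℂ) * α ^ k) = 0 := by
    intro d
    induction d with
    | zero =>
      intro c hc
      have : c = 0 := by simpa [Nat.WithBot.lt_zero_iff] using hc
      subst this; ext; simp
    | succ d ih =>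
      intro c hc
      have hstep : (shiftEnd - algebraMap ℂ _ α) (fun k : ℕ => c.eval (k : ℂ) * α ^ k) =
          fun k : ℕ => (C α * (taylor 1 c - c)).eval (k : ℂ) * α ^ k := by
        ext k
        simp [shiftEnd, LinearMap.funLeft_apply, taylor_eval, Module.algebraMap_end_apply, pow_succ]
        ring_nf
      rw [pow_succ, Module.End.mul_apply, hstep]
      refine ih _ ?_
      by_cases hc0 : c = 0
      · simp [hc0]
      have hlt : (taylor 1 c - c).degree < c.degree := by
        have := degree_sub_lt_left (p := taylor 1 c) (q := c) (degree_taylor _ _)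
          (by simpa using hc0) (leadingCoeff_taylor _ _)
        rwa [degree_taylor] at this
      have h1 : (C α * (taylor 1 c - c)).degree ≤ (taylor 1 c - c).degree := by
        by_cases hα : α = 0
        · simp [hα]
        · rw [degree_C_mul hα]
      rw [degree_eq_natDegree hc0] at hlt hc
      have h2 : c.natDegree < d + 1 := by exact_mod_cast hc
      exact h1.trans_lt (hlt.trans_le (by exact_mod_cast Nat.lt_succ_iff.mp h2))
  refine (Module.End.mem_maxGenEigenspace _ _ _).2 ⟨c.natDegree + 1, ?_⟩
  have := key (c.natDegree + 1) c
    (degree_le_natDegree.trans_lt (by exact_mod_cast Nat.lt_succ_self _))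
  rwa [Algebra.algebraMap_eq_smul_one] at this

open Polynomial in
/-- An exponential polynomial that vanishes on the diagonal is formally zero. -/
theorem eq_zero_of_expPolyEval_diag_eq_zero {f : MonoidAlgebra ℂ[X] ℂˣ}
    (hf : ∀ k, expPolyEval k k f = 0) : f = 0 := by
  have hsum (k : ℕ) : expPolyEval k k f =
      ∑ α ∈ f.coeff.support, (f.coeff α).eval (k : ℂ) * (α : ℂ) ^ k := by
    conv_lhs => rw [← MonoidAlgebra.sum_coeff_single f]
    simp [Finsupp.sum, map_sum]
  -- Generalized eigenspaces of the shift for distinct `α` are independent, so each summand vanishes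
  -- separately.
  have hind := (shiftEnd.independent_maxGenEigenspace).comp (Units.val_injective (α := ℂ))
  have hz := (iSupIndep_iff_finsetSum_eq_zero_imp_eq_zero _).1 hind f.coeff.support
    (fun α k => (f.coeff α).eval (k : ℂ) * (α : ℂ) ^ k)
    (fun α _ => mul_pow_mem_maxGenEigenspace_shiftEnd _ _)
    (by ext k; simpa [← hsum] using hf k)
  ext1
  ext1 α
  by_contra hα
  have hα' := hz α (Finsupp.mem_support_iff.2 hα)
  refine hα (Polynomial.eq_of_eval_mul_natCast_eq one_ne_zero fun k => ?_)
  have := congrFun hα' k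
  simpa using this

open Polynomial in
theorem eq_single_one_of_expPolyEval_diag_eq {f : MonoidAlgebra ℂ[X] ℂˣ} {c : ℂ[X]}
    (hf : ∀ k, expPolyEval k k f = c.eval (k : ℂ)) : f = MonoidAlgebra.single 1 c :=
  sub_eq_zero.1 <| eq_zero_of_expPolyEval_diag_eq_zero fun k => by simp [hf k]

open Polynomial in
theorem eq_one_of_pow_eq_eval {α : ℂ} (hα : α ≠ 0) {c : ℂ[X]}
    (h : ∀ k : ℕ, α ^ k = c.eval (k : ℂ)) : α = 1 := by
  by_contra hne
  have hz := eq_single_one_of_expPolyEval_diag_eq (c := c)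
    (f := MonoidAlgebra.single (Units.mk0 α hα) 1) fun k => by simp [h k]
  have h1 := congrArg (fun f => f.coeff (Units.mk0 α hα)) hz
  have h2 : (1 : ℂˣ) ≠ Units.mk0 α hα := fun h => hne (by simpa using congrArg Units.val h.symm)
  simp [h2] at h1

/-! ### Polynomial growth -/

/-- The sequence `f` is bounded by a polynomial in the index. -/
def PolyGrowth (f : ℕ → ℂ) : Prop :=
  ∃ (C : ℝ) (N : ℕ), 0 ≤ C ∧ ∀ k : ℕ, ‖f k‖ ≤ C * ((k : ℝ) + 1) ^ N

namespace PolyGrowth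

variable {f g : ℕ → ℂ}

theorem of_bounded {C : ℝ} (h : ∀ k, ‖f k‖ ≤ C) : PolyGrowth f :=
  ⟨C, 0, (norm_nonneg _).trans (h 0), by simpa using h⟩

theorem add (hf : PolyGrowth f) (hg : PolyGrowth g) : PolyGrowth fun k => f k + g k := by
  obtain ⟨C, N, hC, hf⟩ := hf
  obtain ⟨D, M, hD, hg⟩ := hg
  refine ⟨C + D, N + M, add_nonneg hC hD, fun k => (norm_add_le _ _).trans ?_⟩
  have h1 : (1 : ℝ) ≤ (k : ℝ) + 1 := by simp
  have hN : ((k : ℝ) + 1) ^ N ≤ ((k : ℝ) + 1) ^ (N + M) := pow_le_pow_right₀ h1 (by omega)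
  have hM : ((k : ℝ) + 1) ^ M ≤ ((k : ℝ) + 1) ^ (N + M) := pow_le_pow_right₀ h1 (by omega)
  rw [add_mul]
  exact add_le_add ((hf k).trans (by gcongr)) ((hg k).trans (by gcongr))

theorem mul (hf : PolyGrowth f) (hg : PolyGrowth g) : PolyGrowth fun k => f k * g k := by
  obtain ⟨C, N, hC, hf⟩ := hf
  obtain ⟨D, M, hD, hg⟩ := hg
  refine ⟨C * D, N + M, mul_nonneg hC hD, fun k => ?_⟩
  rw [norm_mul, pow_add, mul_mul_mul_comm]
  exact mul_le_mul (hf k) (hg k) (norm_nonneg _) (by positivity)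

theorem sum {ι : Type*} (s : Finset ι) {f : ι → ℕ → ℂ} (hf : ∀ i ∈ s, PolyGrowth (f i)) :
    PolyGrowth fun k => ∑ i ∈ s, f i k := by
  classical
  induction s using Finset.induction_on with
  | empty => exact of_bounded (C := 0) (by simp)
  | insert a s ha ih =>
    simp only [Finset.sum_insert ha]
    exact (hf a (by simp)).add (ih fun i hi => hf i (by simp [hi]))

theorem natCast : PolyGrowth fun k => (k : ℂ) :=
  ⟨1, 1, zero_le_one, fun k => by simp⟩

theorem pow (hf : PolyGrowth f) (j : ℕ) : PolyGrowth fun k => f k ^ j := by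
  induction j with
  | zero => exact of_bounded (C := 1) (by simp)
  | succ j ih => simpa only [pow_succ] using ih.mul hf

theorem eval (p : Polynomial ℂ) : PolyGrowth fun k => p.eval (k : ℂ) := by
  simp only [Polynomial.eval_eq_sum_range]
  exact sum _ fun i _ => (of_bounded (C := ‖p.coeff i‖) fun _ => le_rfl).mul (natCast.pow i)

theorem comp_div (hf : PolyGrowth f) (K : ℕ) : PolyGrowth fun k => f (k / K) := by
  obtain ⟨C, N, hC, hf⟩ := hf
  refine ⟨C, N, hC, fun k => (hf _).trans ?_⟩
  have : ((k / K : ℕ) : ℝ) ≤ k := by exact_mod_cast Nat.div_le_self k K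
  gcongr

theorem comp_mod (f : ℕ → ℂ) {K : ℕ} (hK : K ≠ 0) : PolyGrowth fun k => f (k % K) :=
  of_bounded (C := ∑ r ∈ Finset.range K, ‖f r‖) fun k =>
    Finset.single_le_sum (f := fun r => ‖f r‖) (fun _ _ => norm_nonneg _)
      (Finset.mem_range.2 (Nat.mod_lt k (Nat.pos_of_ne_zero hK)))

end PolyGrowth

theorem polyGrowth_mul_apply {n : Type*} [Fintype n] {F G : ℕ → Matrix n n ℂ}
    (hF : ∀ i j, PolyGrowth fun k => F k i j) (hG : ∀ i j, PolyGrowth fun k => G k i j) (i j : n) :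
    PolyGrowth fun k => (F k * G k) i j := by
  simp only [Matrix.mul_apply]
  exact PolyGrowth.sum _ fun l _ => (hF i l).mul (hG l j)

/-! ### Integral matrices whose powers grow polynomially -/

section MatrixGrowth

variable {n : Type*} [Fintype n] [DecidableEq n]

theorem polyGrowth_pow_of_isNilpotent_sub_one {u : Matrix n n ℂ} (hu : IsNilpotent (u - 1))
    (i j : n) : PolyGrowth fun k => (u ^ k) i j := by
  obtain ⟨Q, hQ⟩ := exists_polynomial_matrix_eval_eq_pow hu
  simpa only [← hQ, Matrix.map_apply] using PolyGrowth.eval (Q i j)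

/-- Division with remainder: `d ^ k` is a power of `d ^ K` times one of finitely many matrices. -/
theorem polyGrowth_pow_of_pow {d : Matrix n n ℂ} {K : ℕ} (hK : K ≠ 0)
    (hd : ∀ i j, PolyGrowth fun k => ((d ^ K) ^ k) i j) (i j : n) :
    PolyGrowth fun k => (d ^ k) i j := by
  have h (k : ℕ) : d ^ k = (d ^ K) ^ (k / K) * d ^ (k % K) := by
    rw [← pow_mul, ← pow_add, Nat.div_add_mod]
  simp only [fun k => congrFun₂ (h k) i j]
  exact polyGrowth_mul_apply (fun a b => (hd a b).comp_div K)
    (fun a b => PolyGrowth.comp_mod (fun k => (d ^ k) a b) hK) i j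

/-- An integral matrix congruent to `1` modulo `3` whose powers grow polynomially is unipotent. -/
theorem isNilpotent_sub_one_of_polyGrowth {d B : Matrix n n ℤ} (hB : d - 1 = 3 • B)
    (hd : ∀ i j, PolyGrowth fun k => (((Int.castRingHom ℂ).mapMatrix d) ^ k) i j) :
    IsNilpotent (d - 1) := by
  -- Since `(d - 1) ^ k = 3 ^ k • B ^ k`, while binomial expansion bounds its entries by `2 ^ k`
  -- times a polynomial, the integer entries of `B ^ k` tend to zero because `2 < 3`.
  have hent (i j : n) : ∀ᶠ k in Filter.atTop, (B ^ k) i j = 0 := by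
    obtain ⟨C, N, hC, h⟩ := hd i j
    have hbd (k : ℕ) : |((B ^ k) i j : ℝ)| ≤ C * (((k : ℝ) + 1) ^ N * (2 / 3) ^ k) := by
      have h1 : (3 : ℤ) ^ k * (B ^ k) i j = ((d - 1) ^ k) i j := by
        rw [hB, smul_pow]
        simp
      have h2 : (d - 1) ^ k =
          ∑ l ∈ Finset.range (k + 1), ((-1) ^ (k - l) * k.choose l : ℤ) • d ^ l := by
        rw [sub_eq_add_neg, (Commute.neg_one_right d).add_pow]
        refine Finset.sum_congr rfl fun l _ => ?_
        rw [zsmul_eq_mul', mul_assoc]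
        push_cast
        rfl
      have h3 (l : ℕ) : |((d ^ l) i j : ℝ)| ≤ C * ((l : ℝ) + 1) ^ N := by
        have : ‖(((Int.castRingHom ℂ).mapMatrix d) ^ l) i j‖ ≤ _ := h l
        rw [← map_pow] at this
        simpa using this
      have h4 : |(((d - 1) ^ k) i j : ℝ)| ≤ 2 ^ k * (C * ((k : ℝ) + 1) ^ N) := by
        rw [h2, Matrix.sum_apply]
        push_cast [Matrix.smul_apply, smul_eq_mul]
        refine (Finset.abs_sum_le_sum_abs _ _).trans ?_
        rw [show (2 : ℝ) ^ k = ∑ l ∈ Finset.range (k + 1), (k.choose l : ℝ) by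
          exact_mod_cast (Nat.sum_range_choose k).symm, Finset.sum_mul]
        refine Finset.sum_le_sum fun l hl => ?_
        have hlk : (l : ℝ) ≤ k := by exact_mod_cast Nat.lt_succ_iff.1 (Finset.mem_range.1 hl)
        rw [abs_mul, abs_mul, abs_pow, abs_neg, abs_one, one_pow, one_mul, Nat.abs_cast]
        exact mul_le_mul_of_nonneg_left ((h3 l).trans (by gcongr)) (Nat.cast_nonneg _)
      have h5 : (3 : ℝ) ^ k * |((B ^ k) i j : ℝ)| ≤ 2 ^ k * (C * ((k : ℝ) + 1) ^ N) := by
        rw [← h1] at h4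
        push_cast at h4
        rwa [abs_mul, abs_pow, abs_of_pos (by norm_num : (0 : ℝ) < 3)] at h4
      rw [div_pow, show C * (((k : ℝ) + 1) ^ N * (2 ^ k / 3 ^ k)) =
        2 ^ k * (C * ((k : ℝ) + 1) ^ N) / 3 ^ k by ring, le_div_iff₀ (by positivity)]
      linarith
    have hlim : Filter.Tendsto (fun k : ℕ => C * (((k : ℝ) + 1) ^ N * (2 / 3 : ℝ) ^ k))
        Filter.atTop (nhds 0) := by
      have h0 := (Filter.tendsto_add_atTop_iff_nat 1).2
        (tendsto_pow_const_mul_const_pow_of_abs_lt_one N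
          (by rw [abs_of_pos] <;> norm_num : |(2 / 3 : ℝ)| < 1))
      have h1 := h0.const_mul (C * (3 / 2))
      rw [mul_zero] at h1
      refine h1.congr fun k => ?_
      push_cast
      rw [pow_succ]
      ring
    filter_upwards [hlim.eventually_lt_const one_pos] with k hk
    have : |(B ^ k) i j| < 1 := by exact_mod_cast (hbd k).trans_lt hk
    exact Int.abs_lt_one_iff.1 this
  have hall : ∀ᶠ k in Filter.atTop, ∀ i j, (B ^ k) i j = 0 := by
    simpa only [Filter.eventually_all] using hent
  obtain ⟨k, hk⟩ := hall.exists
  refine ⟨k, ?_⟩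
  rw [hB, smul_pow, show B ^ k = 0 by ext i j; exact hk i j, smul_zero]

/-- **Minkowski**: an integral matrix of finite order congruent to `1` modulo `3` is trivial. -/
theorem eq_one_of_pow_eq_one_of_sub_one_eq_smul {d B : Matrix n n ℤ} (hB : d - 1 = 3 • B) {K : ℕ}
    (hK : K ≠ 0) (hd : d ^ K = 1) : d = 1 := by
  refine Matrix.int_eq_of_pow_eq_pow_of_isNilpotent_sub_one
    (isNilpotent_sub_one_of_polyGrowth hB (polyGrowth_pow_of_pow hK fun i j => ?_))
    (by simp) hK (by rw [hd, one_pow])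
  rw [← map_pow, hd, map_one]
  exact PolyGrowth.of_bounded (C := ‖(1 : Matrix n n ℂ) i j‖) fun k => by rw [one_pow]

end MatrixGrowth

/-! ### Groups of unipotent matrices -/

open Polynomial in
/-- Elements of a nonunital algebra of rational matrices of trace zero are nilpotent. -/
theorem isNilpotent_of_mem_of_trace_eq_zero {n : Type*} [Fintype n] [DecidableEq n]
    {A : Submodule ℚ (Matrix n n ℚ)} (hmul : ∀ a ∈ A, ∀ b ∈ A, a * b ∈ A)
    (htr : ∀ a ∈ A, a.trace = 0) {a : Matrix n n ℚ} (ha : a ∈ A) : IsNilpotent a := by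
  obtain ⟨g, hg, hdvd⟩ := a.charpoly.exists_eq_pow_rootMultiplicity_mul_and_not_dvd
    (charpoly_monic a).ne_zero 0
  set m := a.charpoly.rootMultiplicity 0
  rw [map_zero, sub_zero] at hg hdvd
  -- Bézout yields the Fitting idempotent `e` as a polynomial in `a`. The exponent `m + 1` makes
  -- that polynomial divisible by `X` even when `m = 0`, so that `e` lies in `A`.
  have hcop : IsCoprime (X ^ (m + 1)) g :=
    IsCoprime.pow_left ((irreducible_X.coprime_iff_not_dvd).2 hdvd)
  obtain ⟨α, β, hαβ⟩ := hcop
  have hkill : aeval a (X ^ (m + 1) * g) = 0 := by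
    rw [pow_succ', mul_assoc, ← hg, map_mul, Matrix.aeval_self_charpoly, mul_zero]
  have hX (p : ℚ[X]) : aeval a (p * X) ∈ A := by
    induction p using Polynomial.induction_on' with
    | add p q hp hq => rw [add_mul, map_add]; exact A.add_mem hp hq
    | monomial k c =>
      rw [← C_mul_X_pow_eq_monomial, mul_assoc, ← pow_succ, ← smul_eq_C_mul, map_smul, map_pow,
        aeval_X]
      refine A.smul_mem _ ?_
      induction k with
      | zero => simpa using ha
      | succ k ih => rw [pow_succ]; exact hmul _ ih _ ha
  set e := aeval a (α * X ^ (m + 1)) with he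
  have heA : e ∈ A := by
    rw [he, pow_succ, ← mul_assoc]; exact hX _
  have hidem : e * e = e := by
    have h0 : aeval a (α * X ^ (m + 1) * (β * g)) = 0 := by
      rw [show α * X ^ (m + 1) * (β * g) = α * β * (X ^ (m + 1) * g) by ring, map_mul, hkill,
        mul_zero]
    have h1 : α * X ^ (m + 1) * (α * X ^ (m + 1)) =
        α * X ^ (m + 1) - α * X ^ (m + 1) * (β * g) := by
      linear_combination (α * X ^ (m + 1)) * hαβ
    rw [he, ← map_mul, h1, map_sub, h0, sub_zero]
  -- In characteristic zero the trace of an idempotent is its rank.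
  have he0 : e = 0 := by
    have h := LinearMap.IsIdempotentElem.eq_zero_of_trace_eq_zero (e := Matrix.toLin' e)
      (by rw [IsIdempotentElem, Module.End.mul_eq_comp, ← Matrix.toLin'_mul, hidem]) (by
        rw [Matrix.trace_toLin'_eq]; exact htr e heA)
    simpa using h
  refine ⟨m + 1, ?_⟩
  have h2 : (X : ℚ[X]) ^ (m + 1) = X ^ (m + 1) * (α * X ^ (m + 1)) + β * (X ^ (m + 1) * g) := by
    linear_combination -(X : ℚ[X]) ^ (m + 1) * hαβ
  have h3 := congrArg (aeval a) h2
  rw [map_add, map_mul, ← he, he0, map_mul, hkill] at h3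
  simpa using h3

/-- **Wedderburn**: a nonunital algebra of rational matrices of trace zero is nilpotent. -/
theorem exists_pow_eq_bot_of_trace_eq_zero {n : Type*} [Fintype n] [DecidableEq n]
    {A : Submodule ℚ (Matrix n n ℚ)} (hmul : ∀ a ∈ A, ∀ b ∈ A, a * b ∈ A)
    (htr : ∀ a ∈ A, a.trace = 0) : ∃ N, A ^ N = ⊥ := by
  let B : Subalgebra ℚ (Matrix n n ℚ) := Algebra.adjoin ℚ (A : Set (Matrix n n ℚ))
  have hBA : ∀ b ∈ B, ∀ a ∈ A, b * a ∈ A := by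
    intro b hb
    induction hb using Algebra.adjoin_induction with
    | mem x hx => exact hmul x hx
    | algebraMap r =>
      intro a ha
      rw [← Algebra.smul_def]
      exact A.smul_mem r ha
    | add x y _ _ hx hy => intro a ha; rw [add_mul]; exact A.add_mem (hx a ha) (hy a ha)
    | mul x y _ _ hx hy => intro a ha; rw [mul_assoc]; exact hx _ (hy a ha)
  -- `A` is a left ideal of `B` consisting of nilpotent elements, so `y * b + 1` is invertible for
  -- every `y`. The radical of the finite-dimensional algebra `B` is nilpotent.
  have hJ (b : B) (hb : (b : Matrix n n ℚ) ∈ A) : b ∈ Ring.jacobson B := by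
    rw [← Ideal.jacobson_bot, Ideal.mem_jacobson_iff]
    intro y
    have hnil : IsNilpotent (y * b) := by
      obtain ⟨k, hk⟩ := isNilpotent_of_mem_of_trace_eq_zero hmul htr (hBA y y.2 b hb)
      exact ⟨k, Subtype.ext (by simpa using hk)⟩
    obtain ⟨z, hz⟩ := hnil.isUnit_add_one.exists_left_inv
    refine ⟨z, ?_⟩
    rw [Ideal.mem_bot, ← hz]
    noncomm_ring
  have : IsArtinianRing B := IsArtinianRing.of_finite ℚ B
  obtain ⟨N, hN⟩ := IsSemiprimaryRing.isNilpotent (R := B)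
  have hle (k : ℕ) : A ^ k ≤
      (((Ring.jacobson B) ^ k).restrictScalars ℚ).map B.val.toLinearMap := by
    induction k with
    | zero =>
      rw [pow_zero, Submodule.one_le]
      have h : (1 : B) ∈ Ring.jacobson B ^ 0 := by
        rw [Submodule.pow_zero, Ideal.one_eq_top]; trivial
      exact ⟨1, h, by simp⟩
    | succ k ih =>
      rw [pow_succ, Submodule.mul_le]
      intro x hx a ha
      obtain ⟨b, hb, rfl⟩ := ih hx
      have h : b * ⟨a, Algebra.subset_adjoin ha⟩ ∈ Ring.jacobson B ^ (k + 1) := by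
        rw [Submodule.pow_succ]
        exact Ideal.mul_mem_mul hb (hJ _ ha)
      exact ⟨_, h, by simp⟩
  refine ⟨N, le_bot_iff.1 ((hle N).trans ?_)⟩
  rw [hN]
  rintro _ ⟨b, hb, rfl⟩
  have : b = 0 := by simpa using hb
  simp [this]

/-- The augmentation lattice of a group of integral matrices. -/
def augmentationSpan {n : ℕ} (U : Subgroup (GL (Fin n) ℤ)) :
    Submodule ℤ (Matrix (Fin n) (Fin n) ℤ) :=
  Submodule.span ℤ {x | ∃ u ∈ U, x = (u : Matrix (Fin n) (Fin n) ℤ) - 1}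

theorem sub_one_mem_augmentationSpan {n : ℕ} {U : Subgroup (GL (Fin n) ℤ)} {u : GL (Fin n) ℤ}
    (hu : u ∈ U) : (u : Matrix (Fin n) (Fin n) ℤ) - 1 ∈ augmentationSpan U :=
  Submodule.subset_span ⟨u, hu, rfl⟩

/-- **Kolchin**: the augmentation lattice of a group of unipotent matrices is nilpotent. -/
theorem exists_augmentationSpan_pow_eq_bot {n : ℕ} {U : Subgroup (GL (Fin n) ℤ)}
    (hU : ∀ u ∈ U, IsNilpotent ((u : Matrix (Fin n) (Fin n) ℤ) - 1)) :
    ∃ N, augmentationSpan U ^ N = ⊥ := by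
  let f := (Int.castRingHom ℚ).mapMatrix (m := Fin n)
  let A : Submodule ℚ (Matrix (Fin n) (Fin n) ℚ) :=
    Submodule.span ℚ {x | ∃ u ∈ U, x = f ((u : Matrix (Fin n) (Fin n) ℤ) - 1)}
  have hmul : ∀ a ∈ A, ∀ b ∈ A, a * b ∈ A := by
    intro a ha b hb
    have : A * A ≤ A := by
      rw [Submodule.span_mul_span, Submodule.span_le]
      rintro _ ⟨_, ⟨u, hu, rfl⟩, _, ⟨v, hv, rfl⟩, rfl⟩
      have h : f ((u : Matrix (Fin n) (Fin n) ℤ) - 1) * f ((v : Matrix (Fin n) (Fin n) ℤ) - 1) =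
          f (((u * v : GL (Fin n) ℤ) : Matrix (Fin n) (Fin n) ℤ) - 1) -
            f ((u : Matrix (Fin n) (Fin n) ℤ) - 1) - f ((v : Matrix (Fin n) (Fin n) ℤ) - 1) := by
        rw [← map_mul, ← map_sub, ← map_sub, Units.val_mul]
        congr 1
        noncomm_ring
      simp only [SetLike.mem_coe, h]
      exact A.sub_mem (A.sub_mem (Submodule.subset_span ⟨_, U.mul_mem hu hv, rfl⟩)
        (Submodule.subset_span ⟨_, hu, rfl⟩)) (Submodule.subset_span ⟨_, hv, rfl⟩)
    exact this (Submodule.mul_mem_mul ha hb)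
  have htr : ∀ a ∈ A, a.trace = 0 := by
    intro a ha
    induction ha using Submodule.span_induction with
    | mem x hx =>
      obtain ⟨u, hu, rfl⟩ := hx
      exact (Matrix.isNilpotent_trace_of_isNilpotent ((hU u hu).map f)).eq_zero
    | zero => simp
    | add x y _ _ hx hy => rw [Matrix.trace_add, hx, hy, add_zero]
    | smul r x _ hx => rw [Matrix.trace_smul, hx, smul_zero]
  obtain ⟨N, hN⟩ := exists_pow_eq_bot_of_trace_eq_zero hmul htr
  have hle (k : ℕ) : augmentationSpan U ^ k ≤
      ((A ^ k).restrictScalars ℤ).comap f.toIntAlgHom.toLinearMap := by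
    induction k with
    | zero =>
      rw [pow_zero, pow_zero, Submodule.one_le]
      simpa using ⟨1, map_one (algebraMap ℚ (Matrix (Fin n) (Fin n) ℚ))⟩
    | succ k ih =>
      rw [pow_succ, Submodule.mul_le]
      intro x hx a ha
      have h1 : f a ∈ A := by
        have : augmentationSpan U ≤
            (A.restrictScalars ℤ).comap f.toIntAlgHom.toLinearMap := by
          rw [augmentationSpan, Submodule.span_le]
          rintro _ ⟨u, hu, rfl⟩
          exact Submodule.subset_span ⟨u, hu, rfl⟩
        exact this ha
      have h2 : f x ∈ A ^ k := ih hx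
      change f (x * a) ∈ A ^ (k + 1)
      rw [map_mul, pow_succ]
      exact Submodule.mul_mem_mul h2 h1
  refine ⟨N, (Submodule.eq_bot_iff _).2 fun x hx => ?_⟩
  have h : f x ∈ A ^ N := hle N hx
  rw [hN, Submodule.mem_bot] at h
  exact Matrix.map_injective (f := Int.castRingHom ℚ) Int.cast_injective
    (h.trans (map_zero f).symm)

/-! ### Congruence subgroups -/

/-- The principal congruence subgroup of level `r` in `GL(n, ℤ)`. -/
def congruenceKer (n r : ℕ) : Subgroup (GL (Fin n) ℤ) :=
  (GeneralLinearGroup.map (Int.castRingHom (ZMod r))).ker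

theorem mem_congruenceKer_iff_mapMatrix {n r : ℕ} {g : GL (Fin n) ℤ} :
    g ∈ congruenceKer n r ↔
      (Int.castRingHom (ZMod r)).mapMatrix (g : Matrix (Fin n) (Fin n) ℤ) = 1 := by
  rw [congruenceKer, MonoidHom.mem_ker, Units.ext_iff]
  rfl

theorem mapMatrix_intCast_zmod_eq_zero_iff {n r : ℕ} {M : Matrix (Fin n) (Fin n) ℤ} :
    (Int.castRingHom (ZMod r)).mapMatrix M = 0 ↔ ∃ B, M = (r : ℤ) • B := by
  constructor
  · intro h
    have h1 (i j : Fin n) : (r : ℤ) ∣ M i j := by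
      rw [← ZMod.intCast_zmod_eq_zero_iff_dvd]
      · exact congrFun₂ h i j
    choose B hB using h1
    exact ⟨Matrix.of B, by ext i j; simpa using hB i j⟩
  · rintro ⟨B, rfl⟩
    ext i j
    change ((((r : ℤ) • B) i j : ℤ) : ZMod r) = 0
    rw [Matrix.smul_apply]
    simp

theorem mem_congruenceKer {n r : ℕ} {g : GL (Fin n) ℤ} :
    g ∈ congruenceKer n r ↔ ∃ B, (g : Matrix (Fin n) (Fin n) ℤ) - 1 = (r : ℤ) • B := by
  rw [mem_congruenceKer_iff_mapMatrix, ← mapMatrix_intCast_zmod_eq_zero_iff, map_sub, map_one,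
    sub_eq_zero]

theorem congruenceKer_le_of_dvd {n r s : ℕ} (h : r ∣ s) : congruenceKer n s ≤ congruenceKer n r := by
  intro g hg
  obtain ⟨B, hB⟩ := mem_congruenceKer.1 hg
  obtain ⟨t, rfl⟩ := h
  exact mem_congruenceKer.2 ⟨(t : ℤ) • B, by rw [hB, smul_smul]; push_cast; rfl⟩

instance congruenceKer_normal (n r : ℕ) : (congruenceKer n r).Normal :=
  inferInstanceAs (MonoidHom.ker _).Normal

theorem congruenceKer_finiteIndex (n : ℕ) {r : ℕ} (hr : r ≠ 0) :
    (congruenceKer n r).FiniteIndex := by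
  have : NeZero r := ⟨hr⟩
  exact Subgroup.finiteIndex_ker _

/-- In `g ^ p - 1 = (g - 1) * ∑ g ^ i` the sum has `p` terms congruent to `1` modulo `p`, which
contributes one more factor `p`. -/
theorem pow_mem_congruenceKer_pow_succ {n p s : ℕ} (hs : s ≠ 0) {g : GL (Fin n) ℤ}
    (hg : g ∈ congruenceKer n (p ^ s)) : g ^ p ∈ congruenceKer n (p ^ (s + 1)) := by
  obtain ⟨B, hB⟩ := mem_congruenceKer.1 hg
  have h1 (i : ℕ) : g ^ i ∈ congruenceKer n p :=
    congruenceKer_le_of_dvd (dvd_pow_self p hs) (Subgroup.pow_mem _ hg i)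
  choose D hD using fun i => mem_congruenceKer.1 (h1 i)
  refine mem_congruenceKer.2 ⟨B * (1 + ∑ i ∈ Finset.range p, D i), ?_⟩
  have h2 : ∑ i ∈ Finset.range p, (g : Matrix (Fin n) (Fin n) ℤ) ^ i =
      (p : ℤ) • (1 + ∑ i ∈ Finset.range p, D i) := by
    have h3 (i : ℕ) : (g : Matrix (Fin n) (Fin n) ℤ) ^ i = (p : ℤ) • D i + 1 := by
      rw [← hD i, Units.val_pow_eq_pow_val, sub_add_cancel]
    simp only [h3, Finset.sum_add_distrib, ← Finset.smul_sum, smul_add]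
    rw [add_comm]
    simp
  rw [Units.val_pow_eq_pow_val, ← mul_geom_sum, h2, hB]
  simp only [smul_mul_assoc, mul_smul_comm, smul_smul]
  push_cast
  rw [pow_succ']

/-- Modulo `p`, Frobenius gives `g ^ p ^ N - 1 = (g - 1) ^ p ^ N = 0`, as `p ^ N ≥ N`. Each further
`p`-th power gains a factor `p`. -/
theorem pow_mem_congruenceKer {n p N : ℕ} (hp : p.Prime) {g : GL (Fin n) ℤ}
    (hg : ((g : Matrix (Fin n) (Fin n) ℤ) - 1) ^ N = 0) (s : ℕ) :
    g ^ p ^ (s + N) ∈ congruenceKer n (p ^ s) := by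
  have hbase : g ^ p ^ N ∈ congruenceKer n p := by
    have : Fact p.Prime := ⟨hp⟩
    rw [mem_congruenceKer_iff_mapMatrix, Units.val_pow_eq_pow_val, map_pow]
    have h0 := congrArg (Int.castRingHom (ZMod p)).mapMatrix hg
    rw [map_pow, map_sub, map_one, map_zero] at h0
    generalize (Int.castRingHom (ZMod p)).mapMatrix (g : Matrix (Fin n) (Fin n) ℤ) = a at h0 ⊢
    rcases isEmpty_or_nonempty (Fin n) with he | he
    · exact Subsingleton.elim _ _
    have h1 : (a - 1 + 1) ^ p ^ N = (a - 1) ^ p ^ N + 1 ^ p ^ N :=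
      add_pow_char_pow_of_commute _ _ (Commute.one_right _)
    rwa [sub_add_cancel, one_pow, pow_eq_zero_of_le (Nat.lt_pow_self hp.one_lt).le h0,
      zero_add] at h1
  have hind (s : ℕ) : g ^ p ^ (s + N) ∈ congruenceKer n (p ^ (s + 1)) := by
    induction s with
    | zero => simpa using hbase
    | succ s ih =>
      rw [show p ^ (s + 1 + N) = p ^ (s + N) * p by ring, pow_mul]
      exact pow_mem_congruenceKer_pow_succ s.succ_ne_zero ih
  exact congruenceKer_le_of_dvd (pow_dvd_pow p s.le_succ) (hind s)

/-- A form of the Artin–Rees lemma for lattices. -/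
theorem exists_eq_smul_mem_of_eq_smul {M : Type*} [AddCommGroup M] [Module.Finite ℤ M]
    (L : Submodule ℤ M) (q : ℤ) :
    ∃ c : ℕ, ∀ (s : ℕ) (m B : M), m ∈ L → m = q ^ (s + c) • B → ∃ l ∈ L, m = q ^ s • l := by
  obtain ⟨c, hc⟩ := Ideal.exists_pow_inf_eq_pow_smul (Ideal.span {q}) L
  refine ⟨c, fun s m B hm hB => ?_⟩
  have h1 : m ∈ Ideal.span {q} ^ (s + c) • (⊤ : Submodule ℤ M) ⊓ L := by
    refine ⟨?_, hm⟩
    rw [Ideal.span_singleton_pow, hB]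
    exact Submodule.smul_mem_smul (Ideal.mem_span_singleton_self _) trivial
  rw [hc _ (Nat.le_add_left c s), Nat.add_sub_cancel, Ideal.span_singleton_pow,
    Submodule.ideal_span_singleton_smul] at h1
  obtain ⟨l, hl, rfl⟩ := h1
  exact ⟨l, hl.2, rfl⟩

/-! ### Extracting `q`-th roots along powers of the augmentation lattice -/

section AugmentationPowers

variable {n : ℕ} {U : Subgroup (GL (Fin n) ℤ)}

theorem augmentationSpan_mul_le : augmentationSpan U * augmentationSpan U ≤ augmentationSpan U := by
  conv_lhs => rw [augmentationSpan, Submodule.span_mul_span]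
  rw [Submodule.span_le]
  rintro _ ⟨_, ⟨u, hu, rfl⟩, _, ⟨v, hv, rfl⟩, rfl⟩
  have h : ((u : Matrix (Fin n) (Fin n) ℤ) - 1) * ((v : Matrix (Fin n) (Fin n) ℤ) - 1) =
      (((u * v : GL (Fin n) ℤ) : Matrix (Fin n) (Fin n) ℤ) - 1) -
        ((u : Matrix (Fin n) (Fin n) ℤ) - 1) - ((v : Matrix (Fin n) (Fin n) ℤ) - 1) := by
    rw [Units.val_mul]
    noncomm_ring
  simp only [SetLike.mem_coe, h]
  exact Submodule.sub_mem _ (Submodule.sub_mem _ (sub_one_mem_augmentationSpan (U.mul_mem hu hv))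
    (sub_one_mem_augmentationSpan hu)) (sub_one_mem_augmentationSpan hv)

/-- The zeroth power consists of the integral scalar matrices and need not contain the lattice,
hence `k ≠ 0`. -/
theorem augmentationSpan_pow_succ_le {k : ℕ} (hk : k ≠ 0) :
    augmentationSpan U ^ (k + 1) ≤ augmentationSpan U ^ k := by
  obtain ⟨j, rfl⟩ := Nat.exists_eq_succ_of_ne_zero hk
  rw [pow_succ, pow_succ, mul_assoc]
  exact mul_le_mul_right augmentationSpan_mul_le _

variable {k : ℕ} {a : Matrix (Fin n) (Fin n) ℤ} {x y z : GL (Fin n) ℤ}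

theorem sub_one_mul_mem_augmentationSpan_pow (hx : x ∈ U) (ha : a ∈ augmentationSpan U ^ k) :
    ((x : Matrix (Fin n) (Fin n) ℤ) - 1) * a ∈ augmentationSpan U ^ (k + 1) := by
  rw [pow_succ']
  exact Submodule.mul_mem_mul (sub_one_mem_augmentationSpan hx) ha

theorem mul_sub_one_mem_augmentationSpan_pow (hx : x ∈ U) (ha : a ∈ augmentationSpan U ^ k) :
    a * ((x : Matrix (Fin n) (Fin n) ℤ) - 1) ∈ augmentationSpan U ^ (k + 1) := by
  rw [pow_succ]
  exact Submodule.mul_mem_mul ha (sub_one_mem_augmentationSpan hx)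

theorem coe_mul_mem_augmentationSpan_pow (hk : k ≠ 0) (hx : x ∈ U)
    (ha : a ∈ augmentationSpan U ^ k) :
    (x : Matrix (Fin n) (Fin n) ℤ) * a ∈ augmentationSpan U ^ k := by
  have h := Submodule.add_mem _
    (augmentationSpan_pow_succ_le hk (sub_one_mul_mem_augmentationSpan_pow hx ha)) ha
  rwa [sub_mul, one_mul, sub_add_cancel] at h

theorem mul_coe_mem_augmentationSpan_pow (hk : k ≠ 0) (hx : x ∈ U)
    (ha : a ∈ augmentationSpan U ^ k) :
    a * (x : Matrix (Fin n) (Fin n) ℤ) ∈ augmentationSpan U ^ k := by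
  have h := Submodule.add_mem _
    (augmentationSpan_pow_succ_le hk (mul_sub_one_mem_augmentationSpan_pow hx ha)) ha
  rwa [mul_sub, mul_one, sub_add_cancel] at h

/-- Modulo the next power of the augmentation lattice, `(x * z) ^ j` is `x ^ j + j • (z - 1)`. -/
theorem mul_pow_sub_mem_augmentationSpan_pow (hx : x ∈ U) (hz : z ∈ U)
    (hzk : (z : Matrix (Fin n) (Fin n) ℤ) - 1 ∈ augmentationSpan U ^ k) (j : ℕ) :
    (((x * z) ^ j : GL (Fin n) ℤ) : Matrix (Fin n) (Fin n) ℤ) - (x ^ j : GL (Fin n) ℤ) -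
      (j : ℤ) • ((z : Matrix (Fin n) (Fin n) ℤ) - 1) ∈ augmentationSpan U ^ (k + 1) := by
  induction j with
  | zero => simp
  | succ j ih =>
    -- The error at `j + 1` is the error at `j` times `x * z`, plus `(x ^ (j + 1) - 1) * (z - 1)`
    -- and `j • (z - 1) * (x * z - 1)`.
    have h1 := mul_coe_mem_augmentationSpan_pow k.succ_ne_zero (U.mul_mem hx hz) ih
    have h2 := sub_one_mul_mem_augmentationSpan_pow (U.pow_mem hx (j + 1)) hzk
    have h3 := Submodule.smul_mem _ (j : ℤ)
      (mul_sub_one_mem_augmentationSpan_pow (U.mul_mem hx hz) hzk)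
    have h := Submodule.add_mem _ (Submodule.add_mem _ h1 h2) h3
    convert h using 1
    simp only [Units.val_mul, pow_succ, Nat.cast_succ, add_smul, one_smul, sub_mul, mul_sub,
      smul_sub, smul_mul_assoc, mul_assoc, one_mul, mul_one]
    abel

/-- The elements `y - 1`, with `y ∈ U` and `y - 1` in the `k`-th power of the augmentation lattice,
form a group modulo the `k + 1`-st power. -/
def layerLattice (U : Subgroup (GL (Fin n) ℤ)) (k : ℕ) (hk : k ≠ 0) :
    AddSubgroup (Matrix (Fin n) (Fin n) ℤ) where
  carrier := {m | ∃ y ∈ U, (y : Matrix (Fin n) (Fin n) ℤ) - 1 ∈ augmentationSpan U ^ k ∧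
    m - ((y : Matrix (Fin n) (Fin n) ℤ) - 1) ∈ augmentationSpan U ^ (k + 1)}
  zero_mem' := ⟨1, U.one_mem, by simp, by simp⟩
  add_mem' := by
    rintro m₁ m₂ ⟨y₁, hy₁, hk₁, h₁⟩ ⟨y₂, hy₂, hk₂, h₂⟩
    refine ⟨y₁ * y₂, U.mul_mem hy₁ hy₂, ?_, ?_⟩
    · have h := Submodule.add_mem _ (coe_mul_mem_augmentationSpan_pow hk hy₁ hk₂) hk₁
      rwa [mul_sub, mul_one, sub_add_sub_cancel] at h
    · have h := Submodule.sub_mem _ (Submodule.add_mem _ h₁ h₂)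
        (sub_one_mul_mem_augmentationSpan_pow hy₁ hk₂)
      convert h using 1
      rw [Units.val_mul]
      noncomm_ring
  neg_mem' := by
    rintro m ⟨y, hy, hyk, h⟩
    refine ⟨y⁻¹, U.inv_mem hy, ?_, ?_⟩
    · have h := Submodule.neg_mem _ (coe_mul_mem_augmentationSpan_pow hk (U.inv_mem hy) hyk)
      rwa [mul_sub, mul_one, Units.inv_mul, neg_sub] at h
    · have h := Submodule.sub_mem _ (sub_one_mul_mem_augmentationSpan_pow (U.inv_mem hy) hyk) h
      convert h using 1
      rw [mul_sub, mul_one, sub_mul, Units.inv_mul]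
      noncomm_ring

/-- In a group of unipotent integral matrices, an element close to `1` in the `q`-adic topology is
a `q`-th power, and so is its product with a `q`-th power. -/
theorem exists_pow_eq_pow_mul_of_mem_congruenceKer {q N : ℕ} (hq : q.Prime)
    (hN : augmentationSpan U ^ N = ⊥) (j : ℕ) :
    ∀ k ≠ 0, k + j = N → ∃ t : ℕ, ∀ x ∈ U, ∀ w ∈ U,
      (w : Matrix (Fin n) (Fin n) ℤ) - 1 ∈ augmentationSpan U ^ k →
      w ∈ congruenceKer n (q ^ t) → ∃ y ∈ U, y ^ q = x ^ q * w := by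
  induction j with
  | zero =>
    rintro k - rfl
    refine ⟨0, fun x hx w _ hwk _ => ⟨x, hx, ?_⟩⟩
    rw [add_zero] at hN
    rw [hN, Submodule.mem_bot, sub_eq_zero] at hwk
    rw [show w = 1 from Units.ext hwk, mul_one]
  | succ j ih =>
    intro k hk hkj
    obtain ⟨t, ht⟩ := ih (k + 1) k.succ_ne_zero (by omega)
    obtain ⟨c, hc⟩ := exists_eq_smul_mem_of_eq_smul
      (AddSubgroup.toIntSubmodule (layerLattice U k hk)) q
    -- The Artin–Rees constant `c` is lost in writing `w - 1 = q ^ (t + N + 1) • l` with `l` in the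
    -- layer lattice. One factor `q` is spent on the root, and `N` are spent on making `z = y ^ q ^
    -- (t + N)` congruent to `1` modulo `q ^ t`.
    refine ⟨t + N + 1 + c, fun x hx w hw hwk hwt => ?_⟩
    obtain ⟨B, hB⟩ := mem_congruenceKer.1 hwt
    obtain ⟨l, ⟨y, hy, hyk, hl⟩, hwl⟩ := hc (t + N + 1)
      ((w : Matrix (Fin n) (Fin n) ℤ) - 1) B
      (show _ ∈ layerLattice U k hk from ⟨w, hw, hwk, by simp⟩) (by rw [hB]; push_cast; rfl)
    have hyN : ((y : Matrix (Fin n) (Fin n) ℤ) - 1) ^ N = 0 := by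
      have := Submodule.pow_mem_pow _ (sub_one_mem_augmentationSpan hy) N
      rwa [hN, Submodule.mem_bot] at this
    set z := y ^ q ^ (t + N) with hz
    have hzt : z ∈ congruenceKer n (q ^ t) := pow_mem_congruenceKer hq hyN t
    have hzU : z ∈ U := U.pow_mem hy _
    have hzy : (z : Matrix (Fin n) (Fin n) ℤ) - 1 -
        ((q ^ (t + N) : ℕ) : ℤ) • ((y : Matrix (Fin n) (Fin n) ℤ) - 1) ∈
        augmentationSpan U ^ (k + 1) := by
      simpa [hz] using mul_pow_sub_mem_augmentationSpan_pow U.one_mem hy hyk (q ^ (t + N))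
    have hzk : (z : Matrix (Fin n) (Fin n) ℤ) - 1 ∈ augmentationSpan U ^ k := by
      have := Submodule.add_mem _ (augmentationSpan_pow_succ_le hk hzy)
        (Submodule.smul_mem _ ((q ^ (t + N) : ℕ) : ℤ) hyk)
      rwa [sub_add_cancel] at this
    have hxz := U.mul_mem hx hzU
    -- Modulo the next power of the lattice, `(x * z) ^ q` is `x ^ q + q • (z - 1)`, hence `x ^ q +
    -- q ^ (t + N + 1) • (y - 1)`, hence `x ^ q + (w - 1)`, hence `x ^ q * w`.
    have hmain : ((x ^ q * w : GL (Fin n) ℤ) : Matrix (Fin n) (Fin n) ℤ) -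
        ((x * z) ^ q : GL (Fin n) ℤ) ∈ augmentationSpan U ^ (k + 1) := by
      have h1 := mul_pow_sub_mem_augmentationSpan_pow hx hzU hzk q
      have h2 := sub_one_mul_mem_augmentationSpan_pow (U.pow_mem hx q) hwk
      have h3 := Submodule.smul_mem _ (q : ℤ) hzy
      have h4 := Submodule.smul_mem _ ((q : ℤ) ^ (t + N + 1)) hl
      have h := Submodule.add_mem _ (Submodule.sub_mem _ (Submodule.sub_mem _ h2 h1) h3) h4
      convert h using 1
      rw [smul_sub _ l, ← hwl, Units.val_mul]
      push_cast
      rw [smul_sub (q : ℤ) _ (((q : ℤ) ^ (t + N)) • _), smul_smul, ← pow_succ']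
      noncomm_ring
    -- The defect of the approximate root `x * z` lies one layer deeper and is still `1` modulo `q ^
    -- t`, since `z` and `w` are; the induction hypothesis absorbs it.
    obtain ⟨v, hv, hvq⟩ := ht (x * z) hxz (((x * z) ^ q)⁻¹ * (x ^ q * w))
      (U.mul_mem (U.inv_mem (U.pow_mem hxz q)) (U.mul_mem (U.pow_mem hx q) hw))
      (by
        have h := coe_mul_mem_augmentationSpan_pow k.succ_ne_zero
          (U.inv_mem (U.pow_mem hxz q)) hmain
        rwa [mul_sub, Units.inv_mul, ← Units.val_mul] at h)
      (by
        have hwt' : w ∈ congruenceKer n (q ^ t) :=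
          congruenceKer_le_of_dvd (pow_dvd_pow q (by omega)) hwt
        rw [congruenceKer, MonoidHom.mem_ker] at hzt hwt' ⊢
        simp only [map_mul, map_inv, map_pow, hzt, hwt', mul_one, inv_mul_cancel])
    exact ⟨v, hv, by rw [hvq, mul_inv_cancel_left]⟩

/-- In a group of unipotent integral matrices, every element close to `1` in the `q`-adic topology
is a `q`-th power. -/
theorem exists_forall_mem_congruenceKer_exists_pow_eq {q : ℕ} (hq : q.Prime)
    (hU : ∀ u ∈ U, IsNilpotent ((u : Matrix (Fin n) (Fin n) ℤ) - 1)) :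
    ∃ t : ℕ, ∀ w ∈ U, w ∈ congruenceKer n (q ^ t) → ∃ y ∈ U, y ^ q = w := by
  obtain ⟨N, hN⟩ := exists_augmentationSpan_pow_eq_bot hU
  -- The extra power lets the induction start at `k = 1` with `N` layers left, even if `N = 0`.
  have hN' : augmentationSpan U ^ (N + 1) = ⊥ := by rw [pow_succ, hN, Submodule.bot_mul]
  obtain ⟨t, ht⟩ := exists_pow_eq_pow_mul_of_mem_congruenceKer hq hN' N 1 one_ne_zero (add_comm _ _)
  refine ⟨t, fun w hw hwt => ?_⟩
  simpa using ht 1 U.one_mem w hw (by simpa using sub_one_mem_augmentationSpan hw) hwt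

end AugmentationPowers

/-! ### Separation in groups with an integral representation -/

/-- The uniform exponent `n` turns unipotence into one polynomial equation that can be tested modulo
`r`. -/
theorem Matrix.pow_eq_zero_of_isNilpotent {n : ℕ} {M : Matrix (Fin n) (Fin n) ℤ}
    (hM : IsNilpotent M) : M ^ n = 0 := by
  have h := (Matrix.isNilpotent_charpoly_sub_pow_of_isNilpotent hM).eq_zero
  rw [Fintype.card_fin, sub_eq_zero] at h
  simpa [h] using M.aeval_self_charpoly

section Separation

variable {L : Type*} [Group L] {n : ℕ} {L₁ : Subgroup L}

/-- The largest normal subgroup of `L` consisting of elements of `L₁` that act trivially modulo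
`r`. -/
def congruenceCore (ρ : L₁ →* GL (Fin n) ℤ) (r : ℕ) : Subgroup L :=
  (((congruenceKer n r).comap ρ).map L₁.subtype).normalCore

instance congruenceCore_normal (ρ : L₁ →* GL (Fin n) ℤ) (r : ℕ) : (congruenceCore ρ r).Normal :=
  Subgroup.normalCore_normal _

theorem congruenceCore_finiteIndex [L₁.FiniteIndex] (ρ : L₁ →* GL (Fin n) ℤ) {r : ℕ}
    (hr : r ≠ 0) : (congruenceCore ρ r).FiniteIndex := by
  have := congruenceKer_finiteIndex n hr
  have : (((congruenceKer n r).comap ρ).map L₁.subtype).FiniteIndex := by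
    rw [Subgroup.finiteIndex_iff, Subgroup.index_map_subtype, Subgroup.index_comap]
    exact mul_ne_zero ((congruenceKer n r).subgroupOf ρ.range).index_ne_zero_of_finite
      L₁.index_ne_zero_of_finite
  exact Subgroup.finiteIndex_normalCore _

theorem exists_of_mem_congruenceCore {ρ : L₁ →* GL (Fin n) ℤ} {r : ℕ} {x : L}
    (hx : x ∈ congruenceCore ρ r) : ∃ h : x ∈ L₁, ρ ⟨x, h⟩ ∈ congruenceKer n r := by
  obtain ⟨y, hy, rfl⟩ := Subgroup.normalCore_le _ hx
  exact ⟨y.2, hy⟩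

theorem exists_inv_mul_mem_of_mem_sup_congruenceCore {ρ : L₁ →* GL (Fin n) ℤ} {r : ℕ} {Γ : Subgroup L}
    {x : L} (hx : x ∈ Γ ⊔ congruenceCore ρ r) (K : ℕ) :
    ∃ γ ∈ Γ, γ⁻¹ * x ∈ congruenceCore ρ r ∧ (γ ^ K)⁻¹ * x ^ K ∈ congruenceCore ρ r := by
  obtain ⟨γ, hγ, μ, hμ, rfl⟩ := Subgroup.mem_sup_of_normal_right.1 hx
  refine ⟨γ, hγ, by rwa [inv_mul_cancel_left], ?_⟩
  have hμ' := (QuotientGroup.eq_one_iff (N := congruenceCore ρ r) μ).2 hμ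
  rw [← QuotientGroup.eq_one_iff]
  simp [hμ']

/-- If `Γ` is torsion-free and `Γ ∩ L₁` is unipotent, then, for every prime `q`, some subgroup of
finite index that contains `Γ` has no element of order `q`. -/
theorem exists_finiteIndex_forall_pow_eq_one [L₁.Normal] [L₁.FiniteIndex]
    (ρ : L₁ →* GL (Fin n) ℤ) (hρ : Function.Injective ρ)
    (hL₁ : ∀ x ∈ L₁, IsOfFinOrder x → x = 1) {Γ : Subgroup L}
    (hΓ : ∀ γ ∈ Γ, IsOfFinOrder γ → γ = 1)
    (hΓu : ∀ x : L₁, (x : L) ∈ Γ → IsNilpotent ((ρ x : Matrix (Fin n) (Fin n) ℤ) - 1))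
    {q : ℕ} (hq : q.Prime) :
    ∃ Λ₀ : Subgroup L, Λ₀.FiniteIndex ∧ Γ ≤ Λ₀ ∧ ∀ x ∈ Λ₀, x ^ q = 1 → x = 1 := by
  obtain ⟨t, ht⟩ := exists_forall_mem_congruenceKer_exists_pow_eq (q := q)
    (U := (Γ.subgroupOf L₁).map ρ) hq (by rintro _ ⟨x, hx, rfl⟩; exact hΓu x hx)
  have hfin := congruenceCore_finiteIndex ρ (pow_ne_zero t hq.ne_zero)
  refine ⟨Γ ⊔ congruenceCore ρ (q ^ t), Subgroup.finiteIndex_of_le le_sup_right, le_sup_left,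
    fun x hx hxq => ?_⟩
  obtain ⟨γ, hγ, hμ, hpow⟩ := exists_inv_mul_mem_of_mem_sup_congruenceCore hx q
  rw [hxq, mul_one] at hpow
  obtain ⟨hmem, hker⟩ := exists_of_mem_congruenceCore (inv_mem_iff.1 hpow)
  obtain ⟨_, ⟨w, hw, rfl⟩, hwq⟩ := ht _ ⟨_, Γ.pow_mem hγ q, rfl⟩ hker
  have hwγ : (w : L) ^ q = γ ^ q := by
    rw [← map_pow] at hwq
    exact congrArg Subtype.val (hρ hwq)
  -- Both sides are unipotent under `ρ` with the same `q`-th power `γ ^ q`, and unipotent roots are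
  -- unique.
  have hconj : γ * w * γ⁻¹ = w := by
    have hc : γ * w * γ⁻¹ ∈ L₁ := Subgroup.Normal.conj_mem ‹_› _ w.2 γ
    have hq' : (⟨γ * w * γ⁻¹, hc⟩ : L₁) ^ q = w ^ q := by
      ext
      simp only [Subgroup.coe_pow, conj_pow, hwγ]
      rw [← pow_succ', pow_succ, mul_inv_cancel_right]
    have h := Matrix.int_eq_of_pow_eq_pow_of_isNilpotent_sub_one
      (hΓu ⟨γ * w * γ⁻¹, hc⟩ (Γ.mul_mem (Γ.mul_mem hγ hw) (Γ.inv_mem hγ))) (hΓu w hw) hq.ne_zero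
      (by rw [← Units.val_pow_eq_pow_val, ← Units.val_pow_eq_pow_val, ← map_pow, ← map_pow, hq'])
    exact congrArg Subtype.val (hρ (Units.ext h))
  have hcomm : Commute γ (w : L)⁻¹ :=
    Commute.inv_right (mul_inv_eq_iff_eq_mul.1 hconj)
  have hγw : γ * (w : L)⁻¹ = 1 := by
    refine hΓ _ (Γ.mul_mem hγ (Γ.inv_mem hw)) (isOfFinOrder_iff_pow_eq_one.2 ⟨q, hq.pos, ?_⟩)
    rw [hcomm.mul_pow, inv_pow, hwγ, mul_inv_cancel]
  have hγL : γ ∈ L₁ := by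
    rw [mul_inv_eq_one.1 hγw]
    exact w.2
  refine hL₁ x ?_ (isOfFinOrder_iff_pow_eq_one.2 ⟨q, hq.pos, hxq⟩)
  exact (L₁.mul_mem_cancel_left (L₁.inv_mem hγL)).1 (exists_of_mem_congruenceCore hμ).1

/-- Any `r` larger than every entry in absolute value divides no nonzero entry. -/
theorem exists_pos_forall_ne_smul {ι : Type*} [Finite ι] {D : ι → Matrix (Fin n) (Fin n) ℤ}
    (hD : ∀ i, D i ≠ 0) : ∃ r : ℕ, r ≠ 0 ∧ ∀ i B, D i ≠ (r : ℤ) • B := by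
  have := Fintype.ofFinite ι
  refine ⟨1 + ∑ i, ∑ a, ∑ b, (D i a b).natAbs, by omega, fun i B hB => hD i ?_⟩
  ext a b
  refine Int.eq_zero_of_abs_lt_dvd (Dvd.intro (B a b) (congrFun₂ hB a b).symm) ?_
  have h1 : (D i a b).natAbs ≤ ∑ i, ∑ a, ∑ b, (D i a b).natAbs :=
    (Finset.single_le_sum (f := fun b => (D i a b).natAbs) (fun _ _ => Nat.zero_le _)
      (Finset.mem_univ b)).trans <|
    (Finset.single_le_sum (f := fun a => ∑ b, (D i a b).natAbs) (fun _ _ => Nat.zero_le _)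
      (Finset.mem_univ a)).trans <|
    Finset.single_le_sum (f := fun i => ∑ a, ∑ b, (D i a b).natAbs) (fun _ _ => Nat.zero_le _)
      (Finset.mem_univ i)
  rw [Int.abs_eq_natAbs]
  exact_mod_cast Nat.lt_one_add_iff.2 h1

/-- If `Γ ∩ L₁` is unipotent and no conjugate of a suitable power of `η` is unipotent, then some
subgroup of finite index that contains `Γ` misses the conjugacy class of `η`. -/
theorem exists_finiteIndex_forall_conj_notMem [L₁.Normal] [L₁.FiniteIndex]
    (ρ : L₁ →* GL (Fin n) ℤ) {Γ : Subgroup L}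
    (hΓu : ∀ x : L₁, (x : L) ∈ Γ → IsNilpotent ((ρ x : Matrix (Fin n) (Fin n) ℤ) - 1)) {η : L}
    (hη : ∀ (l : L) (x : L₁), (x : L) = l * η ^ L₁.index * l⁻¹ →
      ¬ IsNilpotent ((ρ x : Matrix (Fin n) (Fin n) ℤ) - 1)) :
    ∃ Λ₀ : Subgroup L, Λ₀.FiniteIndex ∧ Γ ≤ Λ₀ ∧ ∀ l, l * η * l⁻¹ ∉ Λ₀ := by
  set K := L₁.index with hK
  have hηK : η ^ K ∈ L₁ := L₁.pow_index_mem η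
  let cj (l : L) : L₁ := ⟨l * η ^ K * l⁻¹, Subgroup.Normal.conj_mem ‹_› _ hηK l⟩
  -- One representative for each coset of `L₁` suffices, because conjugation inside `L₁` does not
  -- affect vanishing modulo `r`.
  obtain ⟨r, hr, hrD⟩ := exists_pos_forall_ne_smul
    (D := fun c : L ⧸ L₁ => ((ρ (cj c.out) : Matrix (Fin n) (Fin n) ℤ) - 1) ^ n)
    fun c h0 => hη c.out (cj c.out) rfl ⟨n, h0⟩
  have hfin := congruenceCore_finiteIndex ρ hr
  refine ⟨Γ ⊔ congruenceCore ρ r, Subgroup.finiteIndex_of_le le_sup_right, le_sup_left,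
    fun l hl => ?_⟩
  obtain ⟨γ, hγ, -, hpow⟩ := exists_inv_mul_mem_of_mem_sup_congruenceCore hl K
  obtain ⟨hmem, hker⟩ := exists_of_mem_congruenceCore hpow
  obtain ⟨h, hh⟩ := QuotientGroup.mk_out_eq_mul L₁ l
  set o := (l : L ⧸ L₁).out with ho
  -- Since `l = o * h⁻¹ = (o * h⁻¹ * o⁻¹) * o`, conjugation by `l` is conjugation by `o` followed by
  -- conjugation by `g`, which lies in `L₁` by normality.
  let g : L₁ := ⟨o * (h : L)⁻¹ * o⁻¹, Subgroup.Normal.conj_mem ‹_› _ (L₁.inv_mem h.2) o⟩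
  have hγK : γ ^ K ∈ L₁ := L₁.pow_index_mem γ
  have hcj : cj l = g * cj o * g⁻¹ := by
    ext
    simp only [cj, g, Subgroup.coe_mul, Subgroup.coe_inv]
    have : l = o * (h : L)⁻¹ := by rw [hh, mul_inv_cancel_right]
    rw [this]
    group
  have hγcj : (⟨_, hγK⟩ : L₁)⁻¹ * cj l = ⟨_, hmem⟩ := by
    ext
    simp only [cj, Subgroup.coe_mul, Subgroup.coe_inv, conj_pow]
  let f := (Int.castRingHom (ZMod r)).mapMatrix (m := Fin n)
  let F := GeneralLinearGroup.map (n := Fin n) (Int.castRingHom (ZMod r))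
  have hF : F (ρ ⟨_, hγK⟩) = F (ρ (cj l)) := by
    have h1 : F (ρ ((⟨_, hγK⟩ : L₁)⁻¹ * cj l)) = 1 := by rw [hγcj]; exact hker
    rwa [map_mul, map_mul, map_inv, map_inv, inv_mul_eq_one] at h1
  have hzero : f (((ρ (cj l) : Matrix (Fin n) (Fin n) ℤ) - 1) ^ n) = 0 := by
    have h2 : f (ρ (cj l) : Matrix (Fin n) (Fin n) ℤ) = f (ρ ⟨_, hγK⟩) :=
      (congrArg Units.val hF).symm
    rw [map_pow, map_sub, h2, ← map_sub, ← map_pow,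
      Matrix.pow_eq_zero_of_isNilpotent (hΓu ⟨_, hγK⟩ (Γ.pow_mem hγ K)), map_zero]
  have hconj : ((ρ (cj o) : Matrix (Fin n) (Fin n) ℤ) - 1) ^ n =
      (ρ g)⁻¹ * ((ρ (cj l) : Matrix (Fin n) (Fin n) ℤ) - 1) ^ n * (ρ g) := by
    rw [← Units.conj_pow']
    congr 1
    rw [hcj, map_mul, map_mul, map_inv, Units.val_mul, Units.val_mul, mul_sub, sub_mul, mul_one,
      Units.inv_mul]
    simp [mul_assoc]
  obtain ⟨B, hB⟩ := mapMatrix_intCast_zmod_eq_zero_iff.1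
    (show f (((ρ (cj o) : Matrix (Fin n) (Fin n) ℤ) - 1) ^ n) = 0 by
      rw [hconj, map_mul, map_mul, hzero, mul_zero, zero_mul])
  exact hrD _ B hB

end Separation

/-! ### Jordan decomposition and generic powers -/

theorem isNilpotent_inv_sub_one {R : Type*} [Ring R] {u : Rˣ} (hu : IsNilpotent ((u : R) - 1)) :
    IsNilpotent (((u⁻¹ : Rˣ) : R) - 1) := by
  have h : ((u⁻¹ : Rˣ) : R) - 1 = -((u⁻¹ : Rˣ) : R) * ((u : R) - 1) := by
    rw [mul_sub, neg_mul, Units.inv_mul]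
    simp [sub_eq_add_neg, add_comm]
  rw [h]
  refine Commute.isNilpotent_mul_left ?_ hu
  exact ((Commute.refl (u : R)).units_inv_left.sub_right (Commute.one_right _)).neg_left

/-- Multiplicative Jordan decomposition of an invertible real matrix. -/
theorem exists_jordan_decomposition {n : ℕ} (g : GL (Fin n) ℝ) :
    ∃ s u : GL (Fin n) ℝ, g = s * u ∧ Commute s u ∧
      IsNilpotent ((u : Matrix (Fin n) (Fin n) ℝ) - 1) ∧
      ∃ p : Polynomial ℝ, p.Separable ∧ Polynomial.aeval (s : Matrix (Fin n) (Fin n) ℝ) p = 0 := by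
  let e := Matrix.toLinAlgEquiv' (R := ℝ) (n := Fin n)
  obtain ⟨N, hN, S, hS, hnil, hss, hf⟩ :=
    Module.End.exists_isNilpotent_isSemisimple (f := e (g : Matrix (Fin n) (Fin n) ℝ))
  have hNg := Algebra.commute_of_mem_adjoin_self hN
  have hNS : Commute N S := Algebra.commute_of_mem_adjoin_singleton_of_commute hS hNg.symm
  have hSeq : S = e g + -N := by rw [hf]; abel
  have hSu : IsUnit S := by
    rw [hSeq]
    exact hnil.neg.isUnit_add_left_of_commute (g.isUnit.map e) hNg.symm.neg_left
  obtain ⟨s, hs⟩ := hSu.map e.symm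
  have hes : e (s : Matrix (Fin n) (Fin n) ℝ) = S := by rw [hs, e.apply_symm_apply]
  have hsN : Commute (s : Matrix (Fin n) (Fin n) ℝ) (e.symm N) := by
    rw [hs]; exact hNS.symm.map e.symm
  have hg : (g : Matrix (Fin n) (Fin n) ℝ) = s + e.symm N := by
    apply e.injective
    rw [map_add, hes, e.apply_symm_apply, add_comm]
    exact hf
  have hsg : Commute s g := by
    have : Commute (s : Matrix (Fin n) (Fin n) ℝ) g := by
      rw [hg]; exact (Commute.refl _).add_right hsN
    exact Units.ext this
  refine ⟨s, s⁻¹ * g, by rw [mul_inv_cancel_left], (Commute.refl s).inv_right.mul_right hsg, ?_,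
    minpoly ℝ S, PerfectField.separable_iff_squarefree.2 hss.minpoly_squarefree, ?_⟩
  · rw [Units.val_mul, hg, mul_add, Units.inv_mul, add_sub_cancel_left]
    exact hsN.units_inv_left.isNilpotent_mul_left (hnil.map e.symm)
  · apply e.injective
    rw [← Polynomial.aeval_algHom_apply e, map_zero]
    exact (congrArg (fun x => Polynomial.aeval x (minpoly ℝ S)) hes).trans (minpoly.aeval ℝ S)

open Polynomial in
/-- The constants as exponential polynomials. -/
noncomputable def expPolyConst : ℂ →+* MonoidAlgebra ℂ[X] ℂˣ :=
  MonoidAlgebra.singleOneRingHom.comp C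

@[simp]
theorem expPolyEval_expPolyConst (k l : ℕ) (c : ℂ) : expPolyEval k l (expPolyConst c) = c := by
  simp [expPolyConst]

-- Polynomial expressions in exponential polynomials are again such. One that is a polynomial on the
-- diagonal has only the base `α = 1`, so off the diagonal it does not depend on `k`. This separates
-- the exponents of the semisimple and unipotent parts.
open Polynomial in
theorem eval_expPolyEval_of_diag {σ : Type*} (x : σ → MonoidAlgebra ℂ[X] ℂˣ)
    (P : MvPolynomial σ ℂ) (c : ℂ[X])
    (h : ∀ k : ℕ, MvPolynomial.eval (fun i => expPolyEval k k (x i)) P = c.eval (k : ℂ))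
    (k l : ℕ) : MvPolynomial.eval (fun i => expPolyEval k l (x i)) P = c.eval (l : ℂ) := by
  have hev (k l : ℕ) : expPolyEval k l (MvPolynomial.eval₂ expPolyConst x P) =
      MvPolynomial.eval (fun i => expPolyEval k l (x i)) P := by
    rw [MvPolynomial.eval₂_comp_left, ← MvPolynomial.eval₂_id]
    congr 1
    ext c
    simp
  have hz := eq_single_one_of_expPolyEval_diag_eq (c := c) fun k => (hev k k).trans (h k)
  rw [← hev, hz]
  simp

theorem exists_expPoly_matrix_of_isNilpotent {n : ℕ} {u : Matrix (Fin n) (Fin n) ℂ}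
    (hu : IsNilpotent (u - 1)) :
    ∃ M : Matrix (Fin n) (Fin n) (MonoidAlgebra (Polynomial ℂ) ℂˣ),
      ∀ k l, (expPolyEval k l).mapMatrix M = u ^ l := by
  obtain ⟨Q, hQ⟩ := exists_polynomial_matrix_eval_eq_pow hu
  refine ⟨Q.map (MonoidAlgebra.single 1), fun k l => ?_⟩
  rw [← hQ l]
  ext i j
  simp

-- Over `ℂ` the separable `p` has distinct roots, and a factor `X` can be cancelled because `s` is
-- invertible.
open Polynomial in
theorem exists_finset_units_of_separable {n : ℕ} {s : GL (Fin n) ℂ} {p : ℂ[X]}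
    (hp : p.Separable) (hs : aeval (s : Matrix (Fin n) (Fin n) ℂ) p = 0) :
    ∃ R : Finset ℂˣ, aeval (s : Matrix (Fin n) (Fin n) ℂ) (∏ α ∈ R, (X - C (α : ℂ))) = 0 := by
  classical
  have h1 : aeval (s : Matrix (Fin n) (Fin n) ℂ) (∏ α ∈ p.roots.toFinset, (X - C α)) = 0 := by
    have hfac := (IsAlgClosed.splits p).eq_prod_roots
    have hroots : (Multiset.map (fun x => X - C x) p.roots).prod =
        ∏ α ∈ p.roots.toFinset, (X - C α) := by
      rw [Finset.prod, Multiset.toFinset_val, (nodup_roots hp).dedup]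
    rw [hroots] at hfac
    rw [hfac, map_mul, aeval_C, ← Algebra.smul_def] at hs
    exact (smul_eq_zero.1 hs).resolve_left (leadingCoeff_ne_zero.2 hp.ne_zero)
  have h2 : aeval (s : Matrix (Fin n) (Fin n) ℂ)
      (∏ α ∈ p.roots.toFinset.erase 0, (X - C α)) = 0 := by
    by_cases h0 : (0 : ℂ) ∈ p.roots.toFinset
    · rw [← Finset.mul_prod_erase _ _ h0, map_mul, map_zero, sub_zero, aeval_X] at h1
      have := congrArg (fun M => ((s⁻¹ : GL (Fin n) ℂ) : Matrix (Fin n) (Fin n) ℂ) * M) h1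
      simpa only [← mul_assoc, Units.inv_mul, one_mul, mul_zero] using this
    · rwa [Finset.erase_eq_of_notMem h0]
  refine ⟨(p.roots.toFinset.erase 0).preimage Units.val Units.val_injective.injOn, ?_⟩
  rw [Finset.prod_preimage Units.val _ _ (fun α => X - C α)]
  · exact h2
  · intro x hx hx'
    exact absurd ⟨Units.mk0 x (Finset.ne_of_mem_erase hx), rfl⟩ hx'

-- Lagrange interpolation at the roots gives matrices `E α` with `s ^ k = ∑ α ^ k • E α`, and
-- likewise for inverses with `α⁻¹`. Inverses are needed because `φ` may involve the entries of
-- `g⁻¹`.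
open Polynomial in
theorem exists_expPoly_matrix_of_separable {n : ℕ} {s : GL (Fin n) ℂ} {p : ℂ[X]}
    (hp : p.Separable) (hs : aeval (s : Matrix (Fin n) (Fin n) ℂ) p = 0) :
    ∃ M M' : Matrix (Fin n) (Fin n) (MonoidAlgebra ℂ[X] ℂˣ),
      (∀ k l, (expPolyEval k l).mapMatrix M = (s ^ k : GL (Fin n) ℂ)) ∧
      ∀ k l, (expPolyEval k l).mapMatrix M' = ((s ^ k)⁻¹ : GL (Fin n) ℂ) := by
  classical
  obtain ⟨R, hR⟩ := exists_finset_units_of_separable hp hs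
  have hcongr (f g : ℂ[X]) (hfg : ∀ α ∈ R, f.eval (α : ℂ) = g.eval (α : ℂ)) :
      aeval (s : Matrix (Fin n) (Fin n) ℂ) f = aeval (s : Matrix (Fin n) (Fin n) ℂ) g := by
    have hdvd : ∏ α ∈ R, (X - C (α : ℂ)) ∣ f - g := by
      refine Finset.prod_dvd_of_coprime
        ((pairwise_coprime_X_sub_C Units.val_injective).set_pairwise _) fun α hα => ?_
      rw [dvd_iff_isRoot, IsRoot, eval_sub, hfg α hα, sub_self]
    obtain ⟨h, hh⟩ := hdvd
    rw [← sub_eq_zero, ← map_sub, hh, map_mul, hR, zero_mul]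
  let I (v : ℂˣ → ℂ) : ℂ[X] := Lagrange.interpolate R Units.val v
  have hI (v : ℂˣ → ℂ) {α : ℂˣ} (hα : α ∈ R) : (I v).eval (α : ℂ) = v α :=
    Lagrange.eval_interpolate_at_node v Units.val_injective.injOn hα
  have hpow (k : ℕ) : aeval (s : Matrix (Fin n) (Fin n) ℂ) (I fun α => (α : ℂ) ^ k) =
      (s ^ k : GL (Fin n) ℂ) := by
    rw [hcongr _ (X ^ k) fun α hα => by rw [hI _ hα]; simp]
    simp
  have hinv (k : ℕ) : aeval (s : Matrix (Fin n) (Fin n) ℂ) (I fun α => ((α⁻¹ : ℂˣ) : ℂ) ^ k) =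
      ((s ^ k)⁻¹ : GL (Fin n) ℂ) := by
    rw [← Units.mul_eq_one_iff_eq_inv, ← hpow k, ← map_mul,
      hcongr _ 1 fun α hα => by
        rw [eval_mul, hI _ hα, hI _ hα, ← mul_pow, Units.inv_mul, one_pow, eval_one], map_one]
  let E (α : ℂˣ) : Matrix (Fin n) (Fin n) ℂ :=
    aeval (s : Matrix (Fin n) (Fin n) ℂ) (Lagrange.basis R Units.val α)
  have hsum (v : ℂˣ → ℂ) : aeval (s : Matrix (Fin n) (Fin n) ℂ) (I v) = ∑ α ∈ R, v α • E α := by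
    simp only [I, E, Lagrange.interpolate_apply, map_sum, map_mul, aeval_C, ← Algebra.smul_def]
  refine ⟨∑ α ∈ R, (MonoidAlgebra.single α (1 : ℂ[X])) • (E α).map expPolyConst,
    ∑ α ∈ R, (MonoidAlgebra.single α⁻¹ (1 : ℂ[X])) • (E α).map expPolyConst,
    fun k l => ?_, fun k l => ?_⟩
  · rw [← hpow, hsum, map_sum]
    refine Finset.sum_congr rfl fun α _ => ?_
    ext i j
    simp
  · rw [← hinv, hsum, map_sum]
    refine Finset.sum_congr rfl fun α _ => ?_
    ext i j
    simp

/-! ### Rational homomorphisms and unipotent elements -/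

section RationalHom

variable {n m : ℕ} {G : Subgroup (GL (Fin n) ℂ)} {φ : realPoints G →* GL (Fin m) ℂ}

/-- If `φ g` is unipotent, the powers of the semisimple part of `g` lie in the kernel of `φ`. -/
theorem exists_jordan_decomposition_pow_mem_ker (hG : IsAlgebraicOverRat G) (hφ : IsRationalHom φ)
    (g : realPoints G) (hg : IsNilpotent ((φ g : Matrix (Fin m) (Fin m) ℂ) - 1)) :
    ∃ s u : GL (Fin n) ℝ, (g : GL (Fin n) ℝ) = s * u ∧ Commute s u ∧
      IsNilpotent ((u : Matrix (Fin n) (Fin n) ℝ) - 1) ∧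
      ∀ k : ℕ, s ^ k ∈ φ.ker.map (realPoints G).subtype := by
  obtain ⟨s, u, hgsu, hsu, hu, p, hp, hsp⟩ := exists_jordan_decomposition (g : GL (Fin n) ℝ)
  refine ⟨s, u, hgsu, hsu, hu, ?_⟩
  let cx := GeneralLinearGroup.map (n := Fin n) Complex.ofRealHom
  have hsp' : Polynomial.aeval (cx s : Matrix (Fin n) (Fin n) ℂ) (p.map Complex.ofRealHom) = 0 := by
    have h := congrArg Complex.ofRealHom.mapMatrix hsp
    rw [map_zero, Polynomial.aeval_def, Polynomial.hom_eval₂] at h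
    rw [Polynomial.aeval_def, Polynomial.eval₂_map, ← h]
    congr 1
    ext x i j
    by_cases hij : i = j <;> simp [Matrix.algebraMap_matrix_apply, hij]
  obtain ⟨M₁, M₁', hM₁, hM₁'⟩ := exists_expPoly_matrix_of_separable hp.map hsp'
  have huc : IsNilpotent ((cx u : Matrix (Fin n) (Fin n) ℂ) - 1) := hu.mapMatrix_sub_one _
  obtain ⟨M₂, hM₂⟩ := exists_expPoly_matrix_of_isNilpotent huc
  obtain ⟨M₂', hM₂'⟩ := exists_expPoly_matrix_of_isNilpotent (isNilpotent_inv_sub_one huc)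
  have hM (k l : ℕ) : (expPolyEval k l).mapMatrix (M₁ * M₂) =
      (cx (s ^ k * u ^ l) : Matrix (Fin n) (Fin n) ℂ) := by
    simp only [map_mul, hM₁, hM₂, map_pow, Units.val_mul, Units.val_pow_eq_pow_val]
  have hM' (k l : ℕ) : (expPolyEval k l).mapMatrix (M₂' * M₁') =
      (cx (s ^ k * u ^ l)⁻¹ : Matrix (Fin n) (Fin n) ℂ) := by
    simp only [map_mul, hM₁', hM₂', map_pow, _root_.mul_inv_rev, map_inv, Units.val_mul, ← inv_pow,
      Units.val_pow_eq_pow_val]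
  have hpow (k : ℕ) : s ^ k * u ^ k = ((g ^ k : realPoints G) : GL (Fin n) ℝ) := by
    rw [Subgroup.coe_pow, hgsu, hsu.mul_pow]
  obtain ⟨S, hS⟩ := hG
  -- The equations of `G` hold at `g ^ k = s ^ k * u ^ k`, that is, on the diagonal, hence at all
  -- `(k, l)`.
  have hmem (k l : ℕ) : s ^ k * u ^ l ∈ realPoints G := by
    refine (hS _).2 fun P hP => ?_
    have h := eval_expPolyEval_of_diag (fun ij : Fin n × Fin n => (M₁ * M₂) ij.1 ij.2)
      (P.map (algebraMap ℚ ℂ)) 0 (fun k => by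
        rw [MvPolynomial.eval_map, ← MvPolynomial.aeval_def, Polynomial.eval_zero]
        have h1 := (hS _).1 (g ^ k).2 P hP
        rw [← hpow, ← hM k k] at h1
        exact h1) k l
    rw [MvPolynomial.eval_map, ← MvPolynomial.aeval_def, Polynomial.eval_zero] at h
    rw [← h, ← hM k l]
    rfl
  obtain ⟨Q, hQ⟩ := exists_polynomial_matrix_eval_eq_pow hg
  obtain ⟨P, hP⟩ := hφ
  have hφv (k l : ℕ) (i j : Fin m) : (φ ⟨_, hmem k l⟩ : Matrix (Fin m) (Fin m) ℂ) i j =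
      MvPolynomial.eval (fun a => expPolyEval k l
        (Sum.elim (fun ij : Fin n × Fin n => (M₁ * M₂) ij.1 ij.2)
          (fun ij : Fin n × Fin n => (M₂' * M₁') ij.1 ij.2) a)) (P i j) := by
    rw [hP]
    congr 2
    funext a
    rcases a with ⟨a, b⟩ | ⟨a, b⟩
    · exact (congrFun₂ (hM k l) a b).symm
    · exact (congrFun₂ (hM' k l) a b).symm
  intro k
  -- The entries of `φ (s ^ k * u ^ l)` are those of `Q` at `l`; for `l = 0` this is `φ g ^ 0 = 1`.
  refine ⟨⟨s ^ k * u ^ 0, hmem k 0⟩, ?_, by simp⟩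
  refine MonoidHom.mem_ker.2 (Units.ext ?_)
  have h0 := hQ 0
  rw [pow_zero] at h0
  rw [Units.val_one, ← h0]
  ext i j
  rw [hφv, eval_expPolyEval_of_diag _ _ (Q i j) fun k => ?_]
  · simp
  rw [← hφv]
  have h1 := congrFun₂ (hQ k) i j
  rw [Matrix.map_apply] at h1
  rw [h1, ← Units.val_pow_eq_pow_val, ← map_pow,
    show (⟨_, hmem k k⟩ : realPoints G) = g ^ k from Subtype.ext (hpow k)]

/-- If `φ` has compact kernel and `φ g` is unipotent, the powers of `g` grow polynomially. -/
theorem polyGrowth_pow_of_isNilpotent_map_sub_one (hG : IsAlgebraicOverRat G)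
    (hφ : IsRationalHom φ)
    (hcpt : IsCompact ((φ.ker.map (realPoints G).subtype : Subgroup (GL (Fin n) ℝ)) :
      Set (GL (Fin n) ℝ)))
    (g : realPoints G) (hg : IsNilpotent ((φ g : Matrix (Fin m) (Fin m) ℂ) - 1)) (i j : Fin n) :
    PolyGrowth fun k => (Complex.ofRealHom.mapMatrix
      ((g : GL (Fin n) ℝ) : Matrix (Fin n) (Fin n) ℝ) ^ k) i j := by
  obtain ⟨s, u, hgsu, hsu, hu, hs⟩ := exists_jordan_decomposition_pow_mem_ker hG hφ g hg
  have hpow (k : ℕ) : Complex.ofRealHom.mapMatrix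
      ((g : GL (Fin n) ℝ) : Matrix (Fin n) (Fin n) ℝ) ^ k =
      Complex.ofRealHom.mapMatrix ((s ^ k : GL (Fin n) ℝ) : Matrix (Fin n) (Fin n) ℝ) *
        Complex.ofRealHom.mapMatrix (u : Matrix (Fin n) (Fin n) ℝ) ^ k := by
    rw [← map_pow, ← map_pow, ← map_mul, ← Units.val_pow_eq_pow_val, ← Units.val_pow_eq_pow_val,
      ← Units.val_mul, hgsu, hsu.mul_pow]
  simp only [fun k => congrFun₂ (hpow k) i j]
  refine polyGrowth_mul_apply (fun a b => ?_)
    (fun a b => polyGrowth_pow_of_isNilpotent_sub_one (hu.mapMatrix_sub_one _) a b) i j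
  have hcont : Continuous fun x : GL (Fin n) ℝ => (x : Matrix (Fin n) (Fin n) ℝ) a b :=
    Units.continuous_val.matrix_elem a b
  obtain ⟨C, hC⟩ := hcpt.exists_bound_of_continuousOn hcont.continuousOn
  exact PolyGrowth.of_bounded (C := C) fun k => by simpa using hC _ (hs k)

open Polynomial in
/-- A rational homomorphism maps no nontrivial unipotent element to a nontrivial diagonalizable
element. -/
theorem map_eq_one_of_isNilpotent_sub_one (hφ : IsRationalHom φ) (g : realPoints G)
    (hg : IsNilpotent (((g : GL (Fin n) ℝ) : Matrix (Fin n) (Fin n) ℝ) - 1))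
    (hd : IsDiagonalizableElt (φ g)) : φ g = 1 := by
  have hgc := hg.mapMatrix_sub_one Complex.ofRealHom
  have hgc' := (isNilpotent_inv_sub_one hg).mapMatrix_sub_one Complex.ofRealHom
  obtain ⟨Q, hQ⟩ := exists_polynomial_matrix_eval_eq_pow hgc
  obtain ⟨Q', hQ'⟩ := exists_polynomial_matrix_eval_eq_pow hgc'
  obtain ⟨P, hP⟩ := hφ
  obtain ⟨T, hT⟩ := hd
  let F : Matrix (Fin m) (Fin m) ℂ[X] := Matrix.of fun i j => MvPolynomial.eval₂ C
    (Sum.elim (fun ij : Fin n × Fin n => Q ij.1 ij.2) fun ij : Fin n × Fin n => Q' ij.1 ij.2) (P i j)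
  have hF (k : ℕ) : (evalRingHom (k : ℂ)).mapMatrix F = ((φ g ^ k : GL (Fin m) ℂ) :
      Matrix (Fin m) (Fin m) ℂ) := by
    ext i j
    rw [← map_pow, hP]
    simp only [RingHom.mapMatrix_apply, Matrix.map_apply, F, Matrix.of_apply]
    rw [MvPolynomial.eval₂_comp_left, ← MvPolynomial.eval₂_id]
    congr 1
    · ext c; simp
    · funext a
      rcases a with ⟨a, b⟩ | ⟨a, b⟩
      · have h := congrFun₂ (hQ k) a b
        rw [← map_pow] at h
        simpa using h
      · have h := congrFun₂ (hQ' k) a b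
        rw [← map_pow, ← Units.val_pow_eq_pow_val, inv_pow] at h
        simpa using h
  set D := T * φ g * T⁻¹ with hD
  have hDdiag : (D : Matrix (Fin m) (Fin m) ℂ) =
      Matrix.diagonal (D : Matrix (Fin m) (Fin m) ℂ).diag := hT.diagonal_diag.symm
  have hne (i : Fin m) : (D : Matrix (Fin m) (Fin m) ℂ).diag i ≠ 0 := by
    have h := (Matrix.isUnit_iff_isUnit_det _).1 D.isUnit
    rw [hDdiag, Matrix.det_diagonal] at h
    exact fun h0 => h.ne_zero (Finset.prod_eq_zero (Finset.mem_univ i) h0)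
  -- The powers of each eigenvalue of `φ g` are given by a polynomial in the exponent, because those
  -- of the unipotent `g` and of its inverse are.
  have hone (i : Fin m) : (D : Matrix (Fin m) (Fin m) ℂ).diag i = 1 := by
    refine eq_one_of_pow_eq_eval (hne i)
      (c := ((C : ℂ →+* ℂ[X]).mapMatrix (T : Matrix (Fin m) (Fin m) ℂ) * F *
        (C : ℂ →+* ℂ[X]).mapMatrix ((T⁻¹ : GL (Fin m) ℂ) : Matrix (Fin m) (Fin m) ℂ)) i i)
      fun k => ?_
    have hC (A : Matrix (Fin m) (Fin m) ℂ) :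
        (evalRingHom (k : ℂ)).mapMatrix ((C : ℂ →+* ℂ[X]).mapMatrix A) = A := by
      ext; simp
    have h1 : (evalRingHom (k : ℂ)).mapMatrix
        ((C : ℂ →+* ℂ[X]).mapMatrix (T : Matrix (Fin m) (Fin m) ℂ) * F *
        (C : ℂ →+* ℂ[X]).mapMatrix ((T⁻¹ : GL (Fin m) ℂ) : Matrix (Fin m) (Fin m) ℂ)) =
        (D : Matrix (Fin m) (Fin m) ℂ) ^ k := by
      rw [map_mul, map_mul, hC, hC, hF, ← Units.val_mul, ← Units.val_mul, ← conj_pow,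
        Units.val_pow_eq_pow_val]
    rw [hDdiag, Matrix.diagonal_pow] at h1
    have h2 := congrFun₂ h1 i i
    simpa using h2.symm
  have hD1 : D = 1 := by
    refine Units.ext ?_
    rw [hDdiag, Units.val_one, ← Matrix.diagonal_one]
    congr 1
    funext i
    exact hone i
  rw [hD] at hD1
  simpa using hD1

end RationalHom

/-! ### Unipotent and diagonalizable elements -/

/-- The entries of `u ^ k` are polynomials in `k`; being bounded, they are constant, so the
exponents `0` and `1` give the same matrix. -/
theorem Matrix.eq_one_of_isNilpotent_sub_one_of_bounded {n : Type*} [Fintype n] [DecidableEq n]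
    {u : Matrix n n ℂ} (hu : IsNilpotent (u - 1))
    (hb : ∀ i j, ∃ C : ℝ, ∀ k : ℕ, ‖(u ^ k) i j‖ ≤ C) : u = 1 := by
  obtain ⟨Q, hQ⟩ := exists_polynomial_matrix_eval_eq_pow hu
  rw [← pow_one u, ← pow_zero u, ← hQ, ← hQ]
  ext i j
  have hdeg : (Q i j).degree ≤ 0 := by
    by_contra! hpos
    obtain ⟨C, hC⟩ := hb i j
    have hlim := (Q i j).tendsto_norm_atTop hpos (z := fun k : ℕ => (k : ℂ))
      (l := Filter.atTop) (by simpa using tendsto_natCast_atTop_atTop (R := ℝ))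
    obtain ⟨k, hk⟩ := (hlim.eventually_gt_atTop C).exists
    have := hC k
    rw [← hQ] at this
    exact absurd hk this.not_gt
  rw [Matrix.map_apply, Matrix.map_apply, Polynomial.eq_C_of_degree_le_zero hdeg,
    Polynomial.eval_C, Polynomial.eval_C]

theorem IsUnipotentSubgroup.isNilpotent_sub_one {m : ℕ} {U : Subgroup (GL (Fin m) ℂ)}
    (hU : IsUnipotentSubgroup U) {u : GL (Fin m) ℂ} (hu : u ∈ U) :
    IsNilpotent ((u : Matrix (Fin m) (Fin m) ℂ) - 1) := by
  obtain ⟨P, hP⟩ := hU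
  obtain ⟨htri, hdiag⟩ := hP u hu
  set T := P * u * P⁻¹ with hT
  have hchar : (T : Matrix (Fin m) (Fin m) ℂ).charpoly = (Polynomial.X - Polynomial.C 1) ^ m := by
    rw [Matrix.charpoly_of_isUpperTriangular _ fun i j hij => htri i j hij]
    simp [hdiag]
  have hTm : ((T : Matrix (Fin m) (Fin m) ℂ) - 1) ^ m = 0 := by
    have h := (T : Matrix (Fin m) (Fin m) ℂ).aeval_self_charpoly
    simpa [hchar] using h
  refine ⟨m, ?_⟩
  have h : (T : Matrix (Fin m) (Fin m) ℂ) - 1 = P * ((u : Matrix (Fin m) (Fin m) ℂ) - 1) *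
      ((P⁻¹ : GL (Fin m) ℂ) : Matrix (Fin m) (Fin m) ℂ) := by
    rw [hT, mul_sub, sub_mul, mul_one, Units.mul_inv, Units.val_mul, Units.val_mul]
  rw [h, Units.conj_pow, Units.mul_left_eq_zero, Units.mul_right_eq_zero] at hTm
  exact hTm

theorem IsDiagonalizableElt.conj_pow {m : ℕ} {g : GL (Fin m) ℂ} (hg : IsDiagonalizableElt g)
    (l : GL (Fin m) ℂ) (k : ℕ) : IsDiagonalizableElt (l * g ^ k * l⁻¹) := by
  obtain ⟨T, hT⟩ := hg
  refine ⟨T * l⁻¹, ?_⟩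
  rw [show T * l⁻¹ * (l * g ^ k * l⁻¹) * (T * l⁻¹)⁻¹ = (T * g * T⁻¹) ^ k by
    rw [_root_.conj_pow]; group, Units.val_pow_eq_pow_val, ← hT.diagonal_diag, Matrix.diagonal_pow]
  exact Matrix.isDiag_diagonal _

/-! ### Arithmetic groups -/

theorem MonoidHom.exists_comp_eq_of_injective {A B C : Type*} [Group A] [Group B] [Group C]
    {f : A →* B} (hf : Function.Injective f) (j : C →* B) (hj : ∀ x, j x ∈ f.range) :
    ∃ ρ : C →* A, ∀ x, f (ρ x) = j x := by
  refine ⟨(MonoidHom.ofInjective hf).symm.toMonoidHom.comp (j.codRestrict f.range hj), fun x => ?_⟩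
  have h := (MonoidHom.ofInjective hf).apply_symm_apply (j.codRestrict f.range hj x)
  exact congrArg Subtype.val h

section Arithmetic

variable {n m : ℕ} {G : Subgroup (GL (Fin n) ℂ)}

/-- `G(ℤ)` as a subgroup of `GL(n, ℤ)`. -/
def intPoints (G : Subgroup (GL (Fin n) ℂ)) : Subgroup (GL (Fin n) ℤ) :=
  (realPoints G).comap (GeneralLinearGroup.map (Int.castRingHom ℝ))

/-- The inclusion of `G(ℤ)` in `G(ℝ)`. -/
def intPointsHom (G : Subgroup (GL (Fin n) ℂ)) : intPoints G →* realPoints G :=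
  ((GeneralLinearGroup.map (Int.castRingHom ℝ)).comp (intPoints G).subtype).codRestrict
    (realPoints G) fun z => z.2

theorem coe_intPointsHom (z : intPoints G) :
    ((intPointsHom G z : GL (Fin n) ℝ) : Matrix (Fin n) (Fin n) ℝ) =
      (Int.castRingHom ℝ).mapMatrix ((z : GL (Fin n) ℤ) : Matrix (Fin n) (Fin n) ℤ) :=
  rfl

theorem ofRealHom_mapMatrix_coe_intPointsHom (z : intPoints G) :
    Complex.ofRealHom.mapMatrix
      ((intPointsHom G z : GL (Fin n) ℝ) : Matrix (Fin n) (Fin n) ℝ) =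
      (Int.castRingHom ℂ).mapMatrix ((z : GL (Fin n) ℤ) : Matrix (Fin n) (Fin n) ℤ) := by
  rw [coe_intPointsHom]
  ext i j
  simp

theorem range_intPointsHom : (intPointsHom G).range = integralPoints G := by
  ext x
  constructor
  · rintro ⟨z, rfl⟩
    exact ⟨z, rfl⟩
  · rintro ⟨z, hz⟩
    have hz' : GeneralLinearGroup.map (Int.castRingHom ℝ) z ∈ realPoints G := by
      rw [hz]; exact x.2
    exact ⟨⟨z, hz'⟩, Subtype.ext hz⟩

variable {φ : realPoints G →* GL (Fin m) ℂ}

/-- Polynomial growth passes from `z ^ K` to `z`, and level 3 turns it into unipotence. The exponent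
`K` accommodates a group that is only virtually unipotent. -/
theorem isNilpotent_sub_one_of_map_pow (hG : IsAlgebraicOverRat G) (hφ : IsRationalHom φ)
    (hcpt : IsCompact ((φ.ker.map (realPoints G).subtype : Subgroup (GL (Fin n) ℝ)) :
      Set (GL (Fin n) ℝ)))
    {z : intPoints G} (hz : (z : GL (Fin n) ℤ) ∈ congruenceKer n 3) {K : ℕ} (hK : K ≠ 0)
    (hu : IsNilpotent ((φ (intPointsHom G z) ^ K : GL (Fin m) ℂ).1 - 1)) :
    IsNilpotent (((z : GL (Fin n) ℤ) : Matrix (Fin n) (Fin n) ℤ) - 1) := by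
  obtain ⟨B, hB⟩ := mem_congruenceKer.1 hz
  refine isNilpotent_sub_one_of_polyGrowth (B := B) (by simpa using hB)
    (polyGrowth_pow_of_pow hK fun i j => ?_)
  rw [← map_pow, ← map_pow] at hu
  have h := polyGrowth_pow_of_isNilpotent_map_sub_one hG hφ hcpt _ hu i j
  rw [ofRealHom_mapMatrix_coe_intPointsHom, Subgroup.coe_pow, Units.val_pow_eq_pow_val,
    map_pow] at h
  exact h

/-- A trivial image is unipotent, so `z` is unipotent; its powers stay in the compact kernel and are
therefore bounded. -/
theorem injective_on_congruenceKer (hG : IsAlgebraicOverRat G) (hφ : IsRationalHom φ)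
    (hcpt : IsCompact ((φ.ker.map (realPoints G).subtype : Subgroup (GL (Fin n) ℝ)) :
      Set (GL (Fin n) ℝ)))
    {z : intPoints G} (hz : (z : GL (Fin n) ℤ) ∈ congruenceKer n 3)
    (h1 : φ (intPointsHom G z) = 1) : z = 1 := by
  have hnil := isNilpotent_sub_one_of_map_pow hG hφ hcpt hz one_ne_zero (by simp [h1])
  refine Subtype.ext (Units.ext (mapMatrix_intCast_complex_injective ?_))
  rw [Subgroup.coe_one, Units.val_one, map_one]
  refine Matrix.eq_one_of_isNilpotent_sub_one_of_bounded (hnil.mapMatrix_sub_one _) fun i j => ?_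
  have hcont : Continuous fun x : GL (Fin n) ℝ => (x : Matrix (Fin n) (Fin n) ℝ) i j :=
    Units.continuous_val.matrix_elem i j
  obtain ⟨C, hC⟩ := hcpt.exists_bound_of_continuousOn hcont.continuousOn
  refine ⟨C, fun k => ?_⟩
  have h := hC (intPointsHom G (z ^ k)) ⟨intPointsHom G (z ^ k), by simp [h1], rfl⟩
  rw [← map_pow, ← Units.val_pow_eq_pow_val, ← Subgroup.coe_pow,
    ← ofRealHom_mapMatrix_coe_intPointsHom]
  simpa using h

/-- An arithmetic group has a torsion-free normal subgroup of finite index with a faithful integral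
representation `ρ` that detects unipotent elements. -/
theorem IsArithmetic.exists_integral_representation {Λ : Subgroup (GL (Fin m) ℂ)}
    (hΛ : IsArithmetic Λ) :
    ∃ (n : ℕ) (L₁ : Subgroup Λ) (ρ : L₁ →* GL (Fin n) ℤ), L₁.Normal ∧ L₁.FiniteIndex ∧
      Function.Injective ρ ∧ (∀ x ∈ L₁, IsOfFinOrder x → x = 1) ∧
      (∀ (x : L₁) (K : ℕ), K ≠ 0 →
        IsNilpotent ((((x : Λ) : GL (Fin m) ℂ) ^ K : GL (Fin m) ℂ).1 - 1) →
        IsNilpotent ((ρ x : Matrix (Fin n) (Fin n) ℤ) - 1)) ∧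
      ∀ x : L₁, IsNilpotent ((ρ x : Matrix (Fin n) (Fin n) ℤ) - 1) →
        IsDiagonalizableElt ((x : Λ) : GL (Fin m) ℂ) → x = 1 := by
  obtain ⟨n, G, φ, hG, hφ, hcpt, hcomm⟩ := hΛ
  let ψ := φ.comp (intPointsHom G)
  have hrange : (⊤ : Subgroup (intPoints G)).map ψ = (integralPoints G).map φ := by
    rw [← range_intPointsHom, ← MonoidHom.range_eq_map, MonoidHom.range_comp]
  let Δ := (congruenceKer n 3).subgroupOf (intPoints G)
  have hfin := congruenceKer_finiteIndex n (r := 3) (by norm_num)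
  have hΔ : (Δ.map ψ).relIndex ((integralPoints G).map φ) ≠ 0 := by
    rw [← hrange, Subgroup.relIndex_map_map, top_sup_eq, Subgroup.relIndex_top_right]
    exact (Subgroup.finiteIndex_of_le (H := Δ) le_sup_left).index_ne_zero
  have hΔΛ : ((Δ.map ψ).subgroupOf Λ).FiniteIndex :=
    ⟨Subgroup.relIndex_ne_zero_trans hΔ hcomm.2⟩
  let f := ψ.comp Δ.subtype
  have hf : Function.Injective f := by
    rw [injective_iff_map_eq_one]
    intro z hz
    exact Subtype.ext (injective_on_congruenceKer hG hφ hcpt z.2 hz)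
  -- On the image of the level 3 subgroup `Δ` the map `φ` can be inverted; `ρ` is this inverse,
  -- restricted to a normal subgroup of `Λ`.
  let L₁ := ((Δ.map ψ).subgroupOf Λ).normalCore
  obtain ⟨ρ, hρ⟩ := MonoidHom.exists_comp_eq_of_injective hf (Λ.subtype.comp L₁.subtype) (by
    intro x
    obtain ⟨z, hz, hzx⟩ := Subgroup.normalCore_le _ x.2
    exact ⟨⟨z, hz⟩, hzx⟩)
  have hρx (x : L₁) : φ (intPointsHom G (ρ x)) = ((x : Λ) : GL (Fin m) ℂ) := hρ x
  have hinj : Function.Injective (((intPoints G).subtype.comp Δ.subtype).comp ρ) := by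
    intro x y hxy
    have h : ρ x = ρ y := Subtype.ext (Subtype.ext hxy)
    exact Subtype.ext (Subtype.ext (by rw [← hρx, ← hρx, h]))
  refine ⟨n, L₁, ((intPoints G).subtype.comp Δ.subtype).comp ρ, Subgroup.normalCore_normal _,
    Subgroup.finiteIndex_normalCore _, hinj, fun x hx hfo => ?_, fun x K hK hu => ?_,
    fun x hu hd => ?_⟩
  · obtain ⟨K, hK, hxK⟩ := isOfFinOrder_iff_pow_eq_one.1 hfo
    obtain ⟨B, hB⟩ := mem_congruenceKer.1 (ρ ⟨x, hx⟩).2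
    have hpow : (((ρ ⟨x, hx⟩ : intPoints G) : GL (Fin n) ℤ) :
        Matrix (Fin n) (Fin n) ℤ) ^ K = 1 := by
      have h : (ρ ⟨x, hx⟩) ^ K = 1 := by
        rw [← map_pow, show (⟨x, hx⟩ : L₁) ^ K = 1 from Subtype.ext hxK, map_one]
      have h' := congrArg (fun z : Δ => ((z : intPoints G) : GL (Fin n) ℤ).1) h
      simpa using h'
    have h1 := eq_one_of_pow_eq_one_of_sub_one_eq_smul (B := B) (by simpa using hB) hK.ne' hpow
    have h2 : (⟨x, hx⟩ : L₁) = 1 := hinj ((Units.ext h1).trans (map_one _).symm)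
    exact congrArg Subtype.val h2
  · refine isNilpotent_sub_one_of_map_pow hG hφ hcpt (ρ x).2 hK ?_
    rw [Subgroup.subtype_apply, hρx]
    exact hu
  · have h := map_eq_one_of_isNilpotent_sub_one hφ (intPointsHom G (ρ x))
      (by rw [coe_intPointsHom]; exact hu.mapMatrix_sub_one _) (by rw [hρx]; exact hd)
    rw [hρx] at h
    exact Subtype.ext (Subtype.ext h)

end Arithmetic

/-! ### The two cases: `η` of finite and of infinite order -/

theorem exists_pow_ne_one_of_isOfFinOrder {L : Type*} [Group L] {η : L} (h : IsOfFinOrder η)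
    (hη : η ≠ 1) : ∃ q k : ℕ, q.Prime ∧ η ^ k ≠ 1 ∧ (η ^ k) ^ q = 1 := by
  have h1 : orderOf η ≠ 1 := fun h => hη (orderOf_eq_one_iff.1 h)
  have hq := Nat.minFac_prime h1
  obtain ⟨k, hk⟩ := Nat.minFac_dvd (orderOf η)
  refine ⟨(orderOf η).minFac, k, hq, fun hk1 => ?_, ?_⟩
  · have hpos : 0 < k := Nat.pos_of_ne_zero fun h0 => by
      rw [h0, mul_zero] at hk
      exact h.orderOf_pos.ne' hk
    have hle := Nat.le_of_dvd hpos (orderOf_dvd_of_pow_eq_one hk1)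
    have : 2 * k ≤ (orderOf η).minFac * k := Nat.mul_le_mul_right k hq.two_le
    omega
  · rw [← pow_mul, mul_comm, ← hk, pow_orderOf_eq_one]

theorem mainTheorem3 {m : ℕ} (Λ Γ : Subgroup (GL (Fin m) ℂ)) (η : GL (Fin m) ℂ)
    (hΛ : IsArithmetic Λ)
    (hΓΛ : Γ ≤ Λ)
    (hΓ_torsionFree : ∀ γ ∈ Γ, IsOfFinOrder γ → γ = 1)
    (hΓ_unipotent : IsVirtuallyUnipotent Γ)
    (hηΛ : η ∈ Λ) (hη : IsSemisimpleElt η) :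
    ∃ Λ₀ : Subgroup (GL (Fin m) ℂ),
      Λ₀ ≤ Λ ∧ Λ₀.relIndex Λ ≠ 0 ∧ Γ ≤ Λ₀ ∧
      {x : GL (Fin m) ℂ | ∃ l ∈ Λ, x = l * η * l⁻¹} ∩ (Λ₀ : Set (GL (Fin m) ℂ)) = ∅ := by
  obtain ⟨n, L₁, ρ, hnorm, hfin, hρ, htf, huni, hdiag⟩ := hΛ.exists_integral_representation
  obtain ⟨U, hUΓ, hUfin, hU⟩ := hΓ_unipotent
  have hΓu (x : L₁) (hx : (x : Λ) ∈ Γ.subgroupOf Λ) :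
      IsNilpotent ((ρ x : Matrix (Fin n) (Fin n) ℤ) - 1) := by
    obtain ⟨K, hK, -, hxK⟩ := Subgroup.exists_pow_mem_of_relIndex_ne_zero hUfin hx
    exact huni x K hK.ne' (hU.isNilpotent_sub_one hxK.1)
  suffices h : ∃ Λ₀ : Subgroup Λ, Λ₀.FiniteIndex ∧ Γ.subgroupOf Λ ≤ Λ₀ ∧
      ∀ l : Λ, l * ⟨η, hηΛ⟩ * l⁻¹ ∉ Λ₀ by
    obtain ⟨Λ₀, hΛ₀, hΓΛ₀, hnot⟩ := h
    refine ⟨Λ₀.map Λ.subtype, Subgroup.map_subtype_le _, ?_, fun γ hγ => ?_, ?_⟩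
    · rw [Subgroup.relIndex, Subgroup.subgroupOf,
        Subgroup.comap_map_eq_self_of_injective Λ.subtype_injective]
      exact hΛ₀.index_ne_zero
    · exact ⟨⟨γ, hΓΛ hγ⟩, hΓΛ₀ hγ, rfl⟩
    · refine Set.eq_empty_of_forall_notMem ?_
      rintro _ ⟨⟨l, hl, rfl⟩, y, hy, hyl⟩
      refine hnot ⟨l, hl⟩ ?_
      rwa [show (⟨l, hl⟩ : Λ) * ⟨η, hηΛ⟩ * ⟨l, hl⟩⁻¹ = y from Subtype.ext hyl.symm]
  -- For `η` of finite order the power `η ^ L₁.index` is trivial, as `L₁` is torsion-free, so the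
  -- unipotence test is void and torsion must be excluded instead.
  by_cases hfo : IsOfFinOrder (⟨η, hηΛ⟩ : Λ)
  · obtain ⟨q, k, hq, hk, hkq⟩ := exists_pow_ne_one_of_isOfFinOrder hfo
      fun h => hη.2 (congrArg Subtype.val h)
    obtain ⟨Λ₀, hΛ₀, hΓΛ₀, hone⟩ := exists_finiteIndex_forall_pow_eq_one ρ hρ htf
      (Γ := Γ.subgroupOf Λ)
      (fun γ hγ h => Subtype.ext (hΓ_torsionFree γ hγ (Λ.subtype.isOfFinOrder h))) hΓu hq
    refine ⟨Λ₀, hΛ₀, hΓΛ₀, fun l hl => hk ?_⟩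
    have h := hone _ (Λ₀.pow_mem hl k) (by
      rw [conj_pow, conj_pow, hkq, mul_one, mul_inv_cancel])
    rwa [conj_pow, conj_eq_one_iff] at h
  · refine exists_finiteIndex_forall_conj_notMem ρ hΓu fun l x hx hnil => hfo ?_
    have h1 := hdiag x hnil (by
      rw [hx]
      exact hη.1.conj_pow (l : GL (Fin m) ℂ) L₁.index)
    rw [h1, Subgroup.coe_one, eq_comm, conj_eq_one_iff] at hx
    exact isOfFinOrder_iff_pow_eq_one.2 ⟨_, Nat.pos_of_ne_zero L₁.index_ne_zero_of_finite, hx⟩
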